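/- Let $\hat e_1=(1,0)$, $\hat e_2=\frac12(1,\sqrt3)$, $\hat e_3=\frac12(-1,\sqrt3)$, let $\mathcal L=\mathbb Z\hat e_1+\mathbb Z\hat e_2$ be the triangular lattice, with the sublattices $\mathcal L^1=\mathbb Z(\hat e_1+\hat e_2)+\mathbb Z(\hat e_2+\hat e_3)$, $\mathcal L^2=\mathcal L^1+\hat e_1$, $\mathcal L^3=\mathcal L^1+\hat e_2$. For $\varepsilon>0$ put $\mathcal L_\varepsilon=\varepsilon\mathcal L$, $\mathcal L^\alpha_\varepsilon=\varepsilon\mathcal L^\alpha$, and let $\mathcal T_\varepsilon$ be the set of closed triangles $T=\mathrm{conv}\{\varepsilon i,\varepsilon j,\varepsilon k\}$ with $i\in\mathcal L^1$, $j\in\mathcal L^2$, $k\in\mathcal L^3$ at mutual distance $1$. For a spin field $u\colon\mathcal L_\varepsilon\to\mathbb S^1$ and $A\subset\mathbb R^2$ set $$F_\varepsilon(u,A)=\sum_{T\in\mathcal T_\varepsilon,\,T\subset A}\varepsilon\,|u(\varepsilon i)+u(\varepsilon j)+u(\varepsilon k)|^2 ,$$ and let the chirality $\chi(u)$ be the function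 that on the interior of each $T\in\mathcal T_\varepsilon$ equals $\frac{2}{3\sqrt3}\big(u(\varepsilon i)\times u(\varepsilon j)+u(\varepsilon j)\times u(\varepsilon k)+u(\varepsilon k)\times u(\varepsilon i)\big)$, where $v\times w=v_1w_2-v_2w_1$. For $\nu\in\mathbb S^1$ let $\nu^\perp=(-\nu_2,\nu_1)$, $R^\nu_{\ell,h}=\{x\in\mathbb R^2: |\langle x,\nu^\perp\rangle|<\ell/2,\ |\langle x,\nu\rangle|<h/2\}$, $Q^\nu=R^\nu_{1,1}$, and $\chi_\nu(x)=1$ if $\langle x,\nu\rangle\ge0$, $\chi_\nu(x)=-1$ otherwise. For $\ell,h>0$ define $$\psi(\ell,h,\nu)=\frac1\ell\inf\Big\{\liminf_{n\to\infty}F_{\varepsilon_n}(u_n,R^\nu_{\ell,h})\Big\}\in[0,+\infty],$$ where the infimum is over all sequences $\varepsilon_n\to0$, $\varepsilon_n>0$, and all spin fields $u_n\colon\mathcal L_{\varepsilon_n}\to\mathbb S^1$ with $\chi(u_n)\to\chi_\nu$ in $L^1(R^\nu_{\ell,h})$. Let $u^{\rm pos}_\varepsilon$ be the spin field equal to $1$,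 $e^{2\pi \mathrm i/3}$, $e^{4\pi \mathrm i/3}$ on $\mathcal L^1_\varepsilon$, $\mathcal L^2_\varepsilon$, $\mathcal L^3_\varepsilon$ respectively, and $u^{\rm neg}_\varepsilon$ the one equal to $1$, $e^{4\pi \mathrm i/3}$, $e^{2\pi \mathrm i/3}$ there. Put $\partial^\pm_\varepsilon Q^\nu=\{x\in\mathcal L_\varepsilon:\pm\langle\nu,x\rangle\ge3\varepsilon,\ \mathrm{dist}(x,\partial Q^\nu)\le3\varepsilon\}$ and $$m_\varepsilon(\nu)=\inf\{F_\varepsilon(u,Q^\nu): u\colon\mathcal L_\varepsilon\to\mathbb S^1,\ u=u^{\rm pos}_\varepsilon\text{ on }\partial^+_\varepsilon Q^\nu,\ u=u^{\rm neg}_\varepsilon\text{ on }\partial^-_\varepsilon Q^\nu\}.$$ Then for every $\nu\in\mathbb S^1$ the limit $\varphi(\nu)=\lim_{\varepsilon\to0^+}m_\varepsilon(\nu)$ exists and is finite, and $$\psi(1,1,\nu)\ \ge\ \varphi(\nu).$$ -/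

import Mathlib

open Filter Topology MeasureTheory
open scoped ENNReal Pointwise

noncomputable section

namespace AFXY

/-- The Euclidean plane. -/
abbrev Plane : Type := EuclideanSpace ℝ (Fin 2)

/-- Counterclockwise rotation by `π / 2`. -/
def perp (ν : Plane) : Plane := !₂[-ν 1, ν 0]

/-- The open rectangle of length `ℓ` and height `h`, centred at the origin, with two sides
orthogonal to `ν`. -/
def rect (ℓ h : ℝ) (ν : Plane) : Set Plane :=
  {x | |inner ℝ x (perp ν)| < ℓ / 2 ∧ |inner ℝ x ν| < h / 2}

/-- The open unit square with one side orthogonal to `ν`. -/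
def square (ν : Plane) : Set Plane := rect 1 1 ν

/-! ### The triangular lattice -/

def e₁ : Plane := !₂[1, 0]

def e₂ : Plane := !₂[1 / 2, √3 / 2]

def e₃ : Plane := !₂[-1 / 2, √3 / 2]

/-- The triangular lattice. -/
def lattice : Set Plane := {x | ∃ z₁ z₂ : ℤ, x = (z₁ : ℝ) • e₁ + (z₂ : ℝ) • e₂}

/-- The translation vectors of the three sublattices. -/
def offset : Fin 3 → Plane := ![0, e₁, e₂]

/-- The three sublattices; the indices `0, 1, 2` stand for the superscripts `1, 2, 3`. -/
def sublattice (α : Fin 3) : Set Plane :=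
  {x | ∃ z₁ z₂ : ℤ, x = (z₁ : ℝ) • (e₁ + e₂) + (z₂ : ℝ) • (e₂ + e₃) + offset α}

theorem e₃_eq : e₃ = e₂ - e₁ := by
  ext i
  fin_cases i <;> simp [e₁, e₂, e₃]
  norm_num

theorem sublattice_subset (α : Fin 3) : sublattice α ⊆ lattice := by
  rintro x ⟨z₁, z₂, rfl⟩
  fin_cases α
  · refine ⟨z₁ - z₂, z₁ + 2 * z₂, ?_⟩
    simp [offset, e₃_eq]
    module
  · refine ⟨z₁ - z₂ + 1, z₁ + 2 * z₂, ?_⟩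
    simp [offset, e₃_eq]
    module
  · refine ⟨z₁ - z₂, z₁ + 2 * z₂ + 1, ?_⟩
    simp [offset, e₃_eq]
    module

/-- A unit triangle of the lattice, given by its vertices. Each such triangle has exactly one vertex
in each of the three sublattices, and the vertices are labelled accordingly. -/
structure Triangle where
  vertex : Fin 3 → Plane
  mem : ∀ α, vertex α ∈ sublattice α
  dist_eq : ∀ α β, α ≠ β → dist (vertex α) (vertex β) = 1

/-- The closed triangle with the vertices `ε i, ε j, ε k`. -/
def Triangle.hull (T : Triangle) (ε : ℝ) : Set Plane :=
  convexHull ℝ (Set.range fun α => ε • T.vertex α)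

/-! ### Spin fields, energy and chirality -/

/-- Spin fields on the scaled lattice; `Circle` is the unit circle of `ℂ`. -/
abbrev SpinField (ε : ℝ) : Type := (ε • lattice : Set Plane) → Circle

/-- The value of a spin field at a vertex of a scaled triangle. -/
def SpinField.at {ε : ℝ} (u : SpinField ε) (T : Triangle) (α : Fin 3) : ℂ :=
  u ⟨ε • T.vertex α, Set.smul_mem_smul_set (sublattice_subset α (T.mem α))⟩

/-- The energy of a spin field in one triangle. -/
def triangleEnergy {ε : ℝ} (u : SpinField ε) (T : Triangle) : ℝ :=
  ε * ‖SpinField.at u T 0 + SpinField.at u T 1 + SpinField.at u T 2‖ ^ 2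

/-- The energy in `A`: the sum over all scaled triangles contained in `A`. -/
def energy {ε : ℝ} (u : SpinField ε) (A : Set Plane) : ℝ≥0∞ :=
  ∑' T : {T : Triangle // T.hull ε ⊆ A}, ENNReal.ofReal (triangleEnergy u T.1)

/-- The cross product of plane vectors, written as complex numbers. -/
def cross (v w : ℂ) : ℝ := v.re * w.im - v.im * w.re

/-- The chirality of a spin field in one triangle. -/
def triangleChirality {ε : ℝ} (u : SpinField ε) (T : Triangle) : ℝ :=
  2 / (3 * √3) *
    (cross (SpinField.at u T 0) (SpinField.at u T 1)
      + cross (SpinField.at u T 1) (SpinField.at u T 2)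
      + cross (SpinField.at u T 2) (SpinField.at u T 0))

open Classical in
/-- The chirality of a spin field as a function on the plane: on the interior of each scaled triangle
(these are pairwise disjoint) it is the chirality in that triangle. The remaining points form a null
set, where the value is `0`. -/
def chirality {ε : ℝ} (u : SpinField ε) (x : Plane) : ℝ :=
  if h : ∃ T : Triangle, x ∈ interior (T.hull ε) then triangleChirality u h.choose else 0

open Classical in
/-- The pure jump function across the line orthogonal to `ν`. -/
def jump (ν : Plane) (x : Plane) : ℝ := if 0 ≤ inner ℝ x ν then 1 else -1

/-! ### The cell formula -/

open Classical in
/-- The ground state of chirality `+1`. -/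
def upos (ε : ℝ) : SpinField ε := fun x =>
  if (x : Plane) ∈ ε • sublattice 0 then Circle.exp 0
  else if (x : Plane) ∈ ε • sublattice 1 then Circle.exp (2 * Real.pi / 3)
  else Circle.exp (4 * Real.pi / 3)

open Classical in
/-- The ground state of chirality `-1`. -/
def uneg (ε : ℝ) : SpinField ε := fun x =>
  if (x : Plane) ∈ ε • sublattice 0 then Circle.exp 0
  else if (x : Plane) ∈ ε • sublattice 1 then Circle.exp (4 * Real.pi / 3)
  else Circle.exp (2 * Real.pi / 3)

/-- The upper discrete boundary of the unit square. -/
def bdryPos (ε : ℝ) (ν : Plane) : Set Plane :=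
  {x | x ∈ ε • lattice ∧ 3 * ε ≤ inner ℝ ν x ∧ Metric.infDist x (frontier (square ν)) ≤ 3 * ε}

/-- The lower discrete boundary of the unit square. -/
def bdryNeg (ε : ℝ) (ν : Plane) : Set Plane :=
  {x | x ∈ ε • lattice ∧ 3 * ε ≤ -inner ℝ ν x ∧ Metric.infDist x (frontier (square ν)) ≤ 3 * ε}

/-- The spin fields that attain the boundary data. -/
def admissible (ε : ℝ) (ν : Plane) : Set (SpinField ε) :=
  {u | (∀ x : (ε • lattice : Set Plane), (x : Plane) ∈ bdryPos ε ν → u x = upos ε x) ∧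
    (∀ x : (ε • lattice : Set Plane), (x : Plane) ∈ bdryNeg ε ν → u x = uneg ε x)}

/-- The least energy in the unit square under the boundary data. -/
def cellMin (ε : ℝ) (ν : Plane) : ℝ≥0∞ := ⨅ u ∈ admissible ε ν, energy u (square ν)

/-- The surface density: the limit of the cell minima as `ε → 0⁺`. -/
def phi (ν : Plane) : ℝ≥0∞ := limUnder (𝓝[>] (0 : ℝ)) fun ε => cellMin ε ν

/-! ### The density obtained by blow-up -/

/-- `ψ(ℓ, h, ν)`: the infimum of the lower limits of the energies in the rectangle, divided by its
length, over all sequences `εₙ → 0⁺` and all spin fields `uₙ` on the `εₙ`-lattice whose chiralities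
converge to the pure jump in `L¹` of the rectangle. -/
def psi (ℓ h : ℝ) (ν : Plane) : ℝ≥0∞ :=
  (ENNReal.ofReal ℓ)⁻¹ *
    sInf {E : ℝ≥0∞ | ∃ (ε : ℕ → ℝ) (u : ∀ n, SpinField (ε n)),
      (∀ n, 0 < ε n) ∧ Tendsto ε atTop (𝓝 0) ∧
      Tendsto (fun n => eLpNorm (fun x => chirality (u n) x - jump ν x) 1
        (volume.restrict (rect ℓ h ν))) atTop (𝓝 0) ∧
      E = liminf (fun n => energy (u n) (rect ℓ h ν)) atTop}

end AFXY

end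

/-! Both claims rest on cut-and-paste constructions, carried out in lattice units, where the energy
in the square is `ε` times a finite sum of costs of unit triangles.

Existence of the limit. Given a competitor at scale `ε` and a much smaller `η`, about `ε / η` copies
of it are lined up along the interface of the finer square, each translated by a vector of the first
sublattice, which leaves the ground states unchanged; elsewhere the field is the pure interface. The
boundary data make copies and surroundings fit together, except at bounded distance from the
interface, in the gaps between copies and in the rest at the end. This gives `cellMin_le_add`, with
an error of order `ε + η / ε`, so the upper limit of the cell minima is at most the lower one.

The lower bound. Fields with chirality near the pure jump are modified near the boundary so that
they become admissible. Dividing by the pure interface gives a phase. On a triangle whose chirality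
does not have the wrong sign, the energy controls the squared phase differences
(`sum_sq_norm_sub_le`, Fourier analysis on three points). Triangles of wrong sign are few, because
each contributes an area of order `ε ^ 2` to the `L¹` distance (`card_bad_le`). The angle of the
phase is then multiplied by a cut-off that vanishes near the boundary. Vortices may exclude a
continuous angle, so the angle is taken with a cut. Averaged over all cuts, the squared angle
difference is at most a multiple of the chord (`integral_cutArg`), and `d ≤ 1 / K ^ 2 + K ^ 2 * d ^
2` converts chords into energy (`exists_cut`).

The cheapest of `J` layers of width `K` (`exists_layer`) costs, up to constants, `ε J K + τ / (ε J)
+ 1 / K + K ^ 2 E / J`, where `τ` bounds the `L¹` distance and `E` the energy. Taking `K` large,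
then `ε J K` of a small order `δ`, then `τ` and `ε` small, makes the error arbitrarily small
(`exists_cellMin_le_add`). -/

noncomputable section

namespace AFXY

/-! ### Coordinates along and across the interface -/

/-- The coordinate along the line orthogonal to `ν`. -/
def along (ν : Plane) : Plane →L[ℝ] ℝ := innerSL ℝ (perp ν)

/-- The coordinate in the direction `ν`. -/
def height (ν : Plane) : Plane →L[ℝ] ℝ := innerSL ℝ ν

theorem along_apply (ν x : Plane) : along ν x = ν 0 * x 1 - ν 1 * x 0 := by
  simp [along, perp, PiLp.inner_apply, Fin.sum_univ_two]
  ring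

theorem height_apply (ν x : Plane) : height ν x = ν 0 * x 0 + ν 1 * x 1 := by
  simp [height, PiLp.inner_apply, Fin.sum_univ_two]
  ring

theorem inner_perp_eq (ν x : Plane) : inner ℝ x (perp ν) = along ν x := by
  rw [real_inner_comm]; rfl

theorem inner_eq_height (ν x : Plane) : inner ℝ x ν = height ν x := by
  rw [real_inner_comm]; rfl

theorem norm_sq_coord (x : Plane) : ‖x‖ ^ 2 = x 0 ^ 2 + x 1 ^ 2 := by
  rw [EuclideanSpace.norm_sq_eq]; simp [Fin.sum_univ_two]

theorem norm_perp (ν : Plane) : ‖perp ν‖ = ‖ν‖ := by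
  rw [← sq_eq_sq₀ (norm_nonneg _) (norm_nonneg _), norm_sq_coord, norm_sq_coord]
  simp [perp]; ring

theorem abs_along_le {ν : Plane} (hν : ‖ν‖ = 1) (x : Plane) : |along ν x| ≤ ‖x‖ := by
  have := abs_real_inner_le_norm (perp ν) x
  rwa [norm_perp, hν, one_mul] at this

theorem abs_height_le {ν : Plane} (hν : ‖ν‖ = 1) (x : Plane) : |height ν x| ≤ ‖x‖ := by
  have := abs_real_inner_le_norm ν x
  rwa [hν, one_mul] at this

theorem abs_along_sub_le {ν : Plane} (hν : ‖ν‖ = 1) (x y : Plane) :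
    |along ν x - along ν y| ≤ dist x y := by
  rw [← map_sub, dist_eq_norm]; exact abs_along_le hν _

theorem abs_height_sub_le {ν : Plane} (hν : ‖ν‖ = 1) (x y : Plane) :
    |height ν x - height ν y| ≤ dist x y := by
  rw [← map_sub, dist_eq_norm]; exact abs_height_le hν _

theorem sq_coord_eq_one {ν : Plane} (hν : ‖ν‖ = 1) : ν 0 ^ 2 + ν 1 ^ 2 = 1 := by
  rw [← norm_sq_coord, hν, one_pow]

theorem along_smul_perp {ν : Plane} (hν : ‖ν‖ = 1) (a : ℝ) : along ν (a • perp ν) = a := by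
  have := sq_coord_eq_one hν
  simp [along_apply, perp]
  linear_combination a * this

theorem height_smul_perp (ν : Plane) (a : ℝ) : height ν (a • perp ν) = 0 := by
  have h : height ν (perp ν) = 0 := by
    rw [height_apply]
    simp only [perp, PiLp.toLp_apply, Matrix.cons_val_zero, Matrix.cons_val_one]
    ring
  rw [map_smul, h, smul_zero]

/-- The rotated frame `(ν^⊥, ν)` preserves the area of rectangles. -/
theorem volume_rotated_rect {ν : Plane} (hν : ‖ν‖ = 1) (a b c d : ℝ) :
    volume {x : Plane | along ν x ∈ Set.Icc a b ∧ height ν x ∈ Set.Icc c d}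
      = ENNReal.ofReal (b - a) * ENNReal.ofReal (d - c) := by
  have h0 : inner ℝ (perp ν) ν = 0 := by
    have := height_smul_perp ν 1
    rwa [one_smul, ← inner_eq_height] at this
  have hon : Orthonormal ℝ ![perp ν, ν] := by
    rw [orthonormal_iff_ite]
    intro i j
    have h0' := h0
    rw [real_inner_comm] at h0'
    fin_cases i <;> fin_cases j <;> simp [h0, h0', norm_perp, hν]
  have hspan : ⊤ ≤ Submodule.span ℝ (Set.range ![perp ν, ν]) := by
    rw [hon.linearIndependent.span_eq_top_of_card_eq_finrank (by simp)]
  set b' := OrthonormalBasis.mk hon hspan with hb'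
  have hm : MeasurePreserving
      (fun x : Plane => (MeasurableEquiv.toLp 2 (Fin 2 → ℝ)).symm (b'.repr x)) volume volume :=
    (EuclideanSpace.volume_preserving_symm_measurableEquiv_toLp (Fin 2)).comp
      b'.measurePreserving_repr
  have hs : {x : Plane | along ν x ∈ Set.Icc a b ∧ height ν x ∈ Set.Icc c d}
      = (fun x : Plane => (MeasurableEquiv.toLp 2 (Fin 2 → ℝ)).symm (b'.repr x)) ⁻¹'
        (Set.Icc ![a, c] ![b, d]) := by
    ext x
    have e0 : (b'.repr x) 0 = along ν x := by
      rw [OrthonormalBasis.repr_apply_apply, hb', OrthonormalBasis.coe_mk]; rfl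
    have e1 : (b'.repr x) 1 = height ν x := by
      rw [OrthonormalBasis.repr_apply_apply, hb', OrthonormalBasis.coe_mk]; rfl
    simp only [Set.mem_ofPred_eq, Set.mem_Icc, Set.mem_preimage, Pi.le_def, Fin.forall_fin_two]
    change _ ↔ ((a ≤ (b'.repr x) 0 ∧ c ≤ (b'.repr x) 1) ∧ ((b'.repr x) 0 ≤ b ∧ (b'.repr x) 1 ≤ d))
    rw [e0, e1]
    tauto
  rw [hs, hm.measure_preimage measurableSet_Icc.nullMeasurableSet, Real.volume_Icc_pi]
  simp [Fin.prod_univ_two]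

/-! ### Lattice coordinates -/

/-- The first coordinate with respect to the basis `e₁, e₂`. -/
def coordA : Plane →L[ℝ] ℝ := innerSL ℝ !₂[1, -(1 / √3)]

/-- The second coordinate with respect to the basis `e₁, e₂`. -/
def coordB : Plane →L[ℝ] ℝ := innerSL ℝ !₂[0, 2 / √3]

theorem coordA_apply (x : Plane) : coordA x = x 0 - x 1 / √3 := by
  simp [coordA, PiLp.inner_apply, Fin.sum_univ_two]
  ring

theorem coordB_apply (x : Plane) : coordB x = 2 * x 1 / √3 := by
  simp [coordB, PiLp.inner_apply, Fin.sum_univ_two]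
  ring

theorem eq_coords (x : Plane) : x = coordA x • e₁ + coordB x • e₂ := by
  have h3 : √3 ≠ 0 := by positivity
  ext i
  fin_cases i
  · simp [coordA_apply, coordB_apply, e₁, e₂]; ring
  · simp [coordA_apply, coordB_apply, e₁, e₂]; field_simp

theorem coordA_comb (a b : ℝ) : coordA (a • e₁ + b • e₂) = a := by
  have h3 : √3 ≠ 0 := by positivity
  simp [coordA_apply, e₁, e₂]; field_simp; ring

theorem coordB_comb (a b : ℝ) : coordB (a • e₁ + b • e₂) = b := by
  have h3 : √3 ≠ 0 := by positivity
  simp [coordB_apply, e₁, e₂]; field_simp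

/-- The basis vectors have inner product `1 / 2`. For differences of lattice points the right side
is an integral quadratic form, so unit distance becomes an equation in integers. -/
theorem norm_sq_lattice_coord (x : Plane) :
    ‖x‖ ^ 2 = coordA x ^ 2 + coordA x * coordB x + coordB x ^ 2 := by
  have h3 : √3 ^ 2 = 3 := Real.sq_sqrt (by norm_num)
  have h3' : √3 ≠ 0 := by positivity
  rw [norm_sq_coord, coordA_apply, coordB_apply]
  field_simp
  linear_combination (x 1 ^ 2) * h3

theorem ext_coords {x y : Plane} (hA : coordA x = coordA y) (hB : coordB x = coordB y) :
    x = y := by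
  rw [eq_coords x, eq_coords y, hA, hB]

theorem abs_coordA_le (x : Plane) : |coordA x| ≤ 2 * ‖x‖ := by
  have := norm_sq_lattice_coord x
  apply abs_le_of_sq_le_sq _ (by positivity)
  nlinarith [sq_nonneg (coordA x + 2 * coordB x), sq_nonneg ‖x‖]

theorem abs_coordB_le (x : Plane) : |coordB x| ≤ 2 * ‖x‖ := by
  have := norm_sq_lattice_coord x
  apply abs_le_of_sq_le_sq _ (by positivity)
  nlinarith [sq_nonneg (coordB x + 2 * coordA x), sq_nonneg ‖x‖]

theorem mem_lattice_iff {x : Plane} :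
    x ∈ lattice ↔ ∃ m n : ℤ, coordA x = m ∧ coordB x = n := by
  constructor
  · rintro ⟨m, n, rfl⟩
    exact ⟨m, n, coordA_comb _ _, coordB_comb _ _⟩
  · rintro ⟨m, n, hm, hn⟩
    exact ⟨m, n, by rw [← hm, ← hn]; exact eq_coords x⟩

/-- The sublattices are the residue classes of `n - m` modulo `3`. -/
theorem mem_sublattice_iff {α : Fin 3} {x : Plane} :
    x ∈ sublattice α ↔ ∃ m n k : ℤ, coordA x = m ∧ coordB x = n ∧
      n - m = 3 * k + ![0, -1, 1] α := by
  have h1 : e₁ + e₂ = (1 : ℝ) • e₁ + (1 : ℝ) • e₂ := by simp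
  have h2 : e₂ + e₃ = (-1 : ℝ) • e₁ + (2 : ℝ) • e₂ := by rw [e₃_eq]; module
  have h3 : offset α = ((![0, 1, 0] α : ℤ) : ℝ) • e₁ + ((![0, 0, 1] α : ℤ) : ℝ) • e₂ := by
    fin_cases α <;> simp [offset]
  have hA : ∀ z₁ z₂ : ℝ, coordA (z₁ • (e₁ + e₂) + z₂ • (e₂ + e₃) + offset α)
      = z₁ - z₂ + (![0, 1, 0] α : ℤ) := by
    intro z₁ z₂
    rw [map_add, map_add, map_smul, map_smul, h1, h2, h3, coordA_comb, coordA_comb, coordA_comb]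
    simp; ring
  have hB : ∀ z₁ z₂ : ℝ, coordB (z₁ • (e₁ + e₂) + z₂ • (e₂ + e₃) + offset α)
      = z₁ + 2 * z₂ + (![0, 0, 1] α : ℤ) := by
    intro z₁ z₂
    rw [map_add, map_add, map_smul, map_smul, h1, h2, h3, coordB_comb, coordB_comb, coordB_comb]
    simp; ring
  constructor
  · rintro ⟨z₁, z₂, rfl⟩
    refine ⟨z₁ - z₂ + ![0, 1, 0] α, z₁ + 2 * z₂ + ![0, 0, 1] α, z₂, ?_, ?_, ?_⟩
    · rw [hA]; push_cast; ring
    · rw [hB]; push_cast; ring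
    · fin_cases α <;> simp <;> ring
  · rintro ⟨m, n, k, hm, hn, hk⟩
    refine ⟨m + k - ![0, 1, 0] α, k, ext_coords ?_ ?_⟩
    · rw [hA, hm]; push_cast; ring
    · rw [hB, hn]
      have : n = m + 3 * k + ![0, -1, 1] α := by linarith
      rw [this]
      fin_cases α <;> simp <;> ring

theorem sublattice_disjoint {α β : Fin 3} {x : Plane} (hα : x ∈ sublattice α)
    (hβ : x ∈ sublattice β) : α = β := by
  obtain ⟨m, n, k, hm, hn, hk⟩ := mem_sublattice_iff.1 hα
  obtain ⟨m', n', k', hm', hn', hk'⟩ := mem_sublattice_iff.1 hβ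
  have h1 : m = m' := by exact_mod_cast hm.symm.trans hm'
  have h2 : n = n' := by exact_mod_cast hn.symm.trans hn'
  subst h1 h2
  fin_cases α <;> fin_cases β <;> simp at hk hk' ⊢ <;> omega

theorem add_mem_sublattice {α : Fin 3} {x t : Plane} (hx : x ∈ sublattice α)
    (ht : t ∈ sublattice 0) : x + t ∈ sublattice α := by
  obtain ⟨m, n, k, hm, hn, hk⟩ := mem_sublattice_iff.1 hx
  obtain ⟨m', n', k', hm', hn', hk'⟩ := mem_sublattice_iff.1 ht
  refine mem_sublattice_iff.2 ⟨m + m', n + n', k + k', ?_, ?_, ?_⟩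
  · rw [map_add, hm, hm']; push_cast; rfl
  · rw [map_add, hn, hn']; push_cast; rfl
  · simp at hk'; linarith

theorem neg_mem_sublattice_zero {t : Plane} (ht : t ∈ sublattice 0) : -t ∈ sublattice 0 := by
  obtain ⟨m, n, k, hm, hn, hk⟩ := mem_sublattice_iff.1 ht
  refine mem_sublattice_iff.2 ⟨-m, -n, -k, ?_, ?_, ?_⟩
  · rw [map_neg, hm]; push_cast; rfl
  · rw [map_neg, hn]; push_cast; rfl
  · simp at hk ⊢; linarith

theorem add_mem_sublattice_iff {α : Fin 3} {x t : Plane} (ht : t ∈ sublattice 0) :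
    x + t ∈ sublattice α ↔ x ∈ sublattice α := by
  refine ⟨fun h => ?_, fun h => add_mem_sublattice h ht⟩
  simpa using add_mem_sublattice h (neg_mem_sublattice_zero ht)

/-- Every point of the plane is within distance `2` of the first sublattice. -/
theorem exists_sublattice_zero_near (x : Plane) : ∃ t ∈ sublattice 0, dist t x ≤ 2 := by
  have h1 : ‖e₁ + e₂‖ ^ 2 = 3 := by
    rw [show e₁ + e₂ = (1 : ℝ) • e₁ + (1 : ℝ) • e₂ by simp, norm_sq_lattice_coord, coordA_comb,
      coordB_comb]; norm_num
  have h2 : ‖e₂ + e₃‖ ^ 2 = 3 := by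
    rw [show e₂ + e₃ = (-1 : ℝ) • e₁ + (2 : ℝ) • e₂ by rw [e₃_eq]; module,
      norm_sq_lattice_coord, coordA_comb, coordB_comb]; norm_num
  have h1' : ‖e₁ + e₂‖ ≤ 2 := by nlinarith [norm_nonneg (e₁ + e₂)]
  have h2' : ‖e₂ + e₃‖ ≤ 2 := by nlinarith [norm_nonneg (e₂ + e₃)]
  -- Coordinates in the basis of the first sublattice, using `e₂ + e₃ = 2 e₂ - e₁`. Rounding moves
  -- each by at most `1 / 2` along a vector of length at most `2`.
  set b := (coordB x - coordA x) / 3 with hb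
  set a := coordA x + b with ha
  have hx : x = a • (e₁ + e₂) + b • (e₂ + e₃) := by
    conv_lhs => rw [eq_coords x]
    rw [ha, e₃_eq]
    have : coordB x = coordA x + 3 * b := by rw [hb]; ring
    rw [this]; module
  refine ⟨(round a : ℝ) • (e₁ + e₂) + (round b : ℝ) • (e₂ + e₃),
    ⟨round a, round b, by simp [offset]⟩, ?_⟩
  rw [dist_eq_norm]
  conv_lhs => rw [hx]
  rw [show (round a : ℝ) • (e₁ + e₂) + (round b : ℝ) • (e₂ + e₃)
    - (a • (e₁ + e₂) + b • (e₂ + e₃))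
    = ((round a : ℝ) - a) • (e₁ + e₂) + ((round b : ℝ) - b) • (e₂ + e₃) by module]
  refine (norm_add_le _ _).trans ?_
  rw [norm_smul, norm_smul, Real.norm_eq_abs, Real.norm_eq_abs, abs_sub_comm, abs_sub_comm _ b]
  have := abs_sub_round a
  have := abs_sub_round b
  nlinarith [abs_nonneg (a - round a), abs_nonneg (b - round b), norm_nonneg (e₁ + e₂),
    norm_nonneg (e₂ + e₃)]

/-! ### Triangles -/

theorem Triangle.ext_vertex {T T' : Triangle} (h : ∀ α, T.vertex α = T'.vertex α) : T = T' := by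
  cases T; cases T'
  congr
  exact funext h

theorem Triangle.dist_le (T : Triangle) (α β : Fin 3) :
    dist (T.vertex α) (T.vertex β) ≤ 1 := by
  rcases eq_or_ne α β with rfl | h
  · simp
  · exact (T.dist_eq α β h).le

theorem Triangle.norm_sub_sq (T : Triangle) {α β : Fin 3} (h : α ≠ β) :
    ‖T.vertex α - T.vertex β‖ ^ 2 = 1 := by
  rw [← dist_eq_norm, T.dist_eq α β h, one_pow]

theorem Triangle.mem_lattice (T : Triangle) (α : Fin 3) : T.vertex α ∈ lattice :=
  sublattice_subset α (T.mem α)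

/-- The hexagon of side one about a lattice point contains the triangles at that point. -/
theorem Triangle.abs_coord_sub_le (T : Triangle) (α β : Fin 3) :
    |coordA (T.vertex β) - coordA (T.vertex α)| ≤ 1 ∧
    |coordB (T.vertex β) - coordB (T.vertex α)| ≤ 1 ∧
    |(coordA + coordB) (T.vertex β) - (coordA + coordB) (T.vertex α)| ≤ 1 := by
  rcases eq_or_ne β α with rfl | h
  · simp
  have hn := T.norm_sub_sq h
  rw [norm_sq_lattice_coord, map_sub, map_sub] at hn
  obtain ⟨m, n, hm, hn'⟩ := mem_lattice_iff.1 (T.mem_lattice α)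
  obtain ⟨m', n', hm', hn''⟩ := mem_lattice_iff.1 (T.mem_lattice β)
  simp only [add_apply]
  rw [hm, hn', hm', hn''] at hn
  rw [hm, hn', hm', hn'']
  have hq : (m' - m) ^ 2 + (m' - m) * (n' - n) + (n' - n) ^ 2 = 1 := by exact_mod_cast hn
  have h1 : |m' - m| ≤ 1 := by
    rw [abs_le_one_iff_mul_self_le_one] ; nlinarith [sq_nonneg (m' - m + 2 * (n' - n))]
  have h2 : |n' - n| ≤ 1 := by
    rw [abs_le_one_iff_mul_self_le_one] ; nlinarith [sq_nonneg (n' - n + 2 * (m' - m))]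
  have h3 : |(m' + n') - (m + n)| ≤ 1 := by
    rw [abs_le_one_iff_mul_self_le_one] ; nlinarith [sq_nonneg (n' - n - (m' - m))]
  refine ⟨?_, ?_, ?_⟩
  · exact_mod_cast h1
  · exact_mod_cast h2
  · exact_mod_cast h3

/-- An interior point can be moved a little in the direction `d` inside `s`, which increases `L`
strictly. -/
theorem lt_of_mem_interior_of_le {L : Plane →L[ℝ] ℝ} {d : Plane} (hd : 0 < L d) {s : Set Plane}
    {c : ℝ} (hs : ∀ x ∈ s, L x ≤ c) {x : Plane} (hx : x ∈ interior s) : L x < c := by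
  have ht : Tendsto (fun t : ℝ => x + t • d) (𝓝[>] 0) (𝓝 x) := by
    have : Continuous fun t : ℝ => x + t • d := by fun_prop
    have h := this.tendsto 0
    simp only [zero_smul, add_zero] at h
    exact h.mono_left nhdsWithin_le_nhds
  have h1 := ht.eventually (mem_interior_iff_mem_nhds.1 hx)
  obtain ⟨t, ht1, ht2⟩ := (h1.and self_mem_nhdsWithin).exists
  have h2 := hs _ ht1
  rw [map_add, map_smul, smul_eq_mul] at h2
  have : 0 < t * L d := mul_pos ht2 hd
  linarith

theorem Triangle.map_hull_le (T : Triangle) {ε c : ℝ} (L : Plane →L[ℝ] ℝ)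
    (h : ∀ α, L (ε • T.vertex α) ≤ c) : ∀ x ∈ T.hull ε, L x ≤ c := by
  have : T.hull ε ⊆ {x | L x ≤ c} := by
    refine convexHull_min ?_ (convex_halfSpace_le L.isLinear c)
    rintro _ ⟨α, rfl⟩
    exact h α
  exact this

theorem Triangle.abs_map_interior_lt (T : Triangle) {ε : ℝ} (hε : 0 < ε) (L : Plane →L[ℝ] ℝ)
    {d : Plane} (hd : 0 < L d) (α : Fin 3)
    (h : ∀ β, |L (T.vertex β) - L (T.vertex α)| ≤ 1) {x : Plane} (hx : x ∈ interior (T.hull ε)) :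
    |L x - ε * L (T.vertex α)| < ε := by
  rw [abs_sub_lt_iff]
  constructor
  · have := lt_of_mem_interior_of_le hd (T.map_hull_le (c := ε + ε * L (T.vertex α)) L ?_) hx
    · linarith
    · intro β
      rw [map_smul, smul_eq_mul]
      have := (abs_le.1 (h β)).2
      nlinarith
  · have := lt_of_mem_interior_of_le (L := -L) (d := -d) (by simpa using hd)
      (T.map_hull_le (c := ε - ε * L (T.vertex α)) (-L) ?_) hx
    · rw [neg_apply] at this; linarith
    · intro β
      rw [neg_apply, map_smul, smul_eq_mul]
      have := (abs_le.1 (h β)).1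
      nlinarith

/-- Distinct triangles have disjoint interiors. -/
theorem Triangle.eq_of_mem_interior {T T' : Triangle} {ε : ℝ} (hε : 0 < ε) {x : Plane}
    (hx : x ∈ interior (T.hull ε)) (hx' : x ∈ interior (T'.hull ε)) : T = T' := by
  refine Triangle.ext_vertex fun α => ?_
  obtain ⟨m, n, k, hm, hn, hk⟩ := mem_sublattice_iff.1 (T.mem α)
  obtain ⟨m', n', k', hm', hn', hk'⟩ := mem_sublattice_iff.1 (T'.mem α)
  have hA1 : coordA e₁ = 1 := by simpa using coordA_comb 1 0
  have hB1 : coordB e₁ = 0 := by simpa using coordB_comb 1 0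
  have hB2 : coordB e₂ = 1 := by simpa using coordB_comb 0 1
  have pA : 0 < coordA e₁ := by rw [hA1]; norm_num
  have pB : 0 < coordB e₂ := by rw [hB2]; norm_num
  have pC : 0 < (coordA + coordB) e₁ := by rw [add_apply, hA1, hB1]; norm_num
  -- The common interior point lies in the open hexagons about both `α` vertices, so each of the
  -- three functionals that bound the hexagon separates these vertices by less than `2`.
  have key : ∀ (L : Plane →L[ℝ] ℝ) (d : Plane), 0 < L d →
      (∀ β, |L (T.vertex β) - L (T.vertex α)| ≤ 1) →
      (∀ β, |L (T'.vertex β) - L (T'.vertex α)| ≤ 1) →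
      |L (T.vertex α) - L (T'.vertex α)| < 2 := by
    intro L d hd h h'
    have h1 := T.abs_map_interior_lt hε L hd α h hx
    have h2 := T'.abs_map_interior_lt hε L hd α h' hx'
    rw [abs_sub_lt_iff] at *
    constructor <;> nlinarith
  have a1 := key coordA e₁ pA (fun β => (T.abs_coord_sub_le α β).1)
    (fun β => (T'.abs_coord_sub_le α β).1)
  have a2 := key coordB e₂ pB (fun β => (T.abs_coord_sub_le α β).2.1)
    (fun β => (T'.abs_coord_sub_le α β).2.1)
  have a3 := key _ e₁ pC (fun β => (T.abs_coord_sub_le α β).2.2)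
    (fun β => (T'.abs_coord_sub_le α β).2.2)
  simp only [add_apply] at a3
  rw [hm, hm'] at a1
  rw [hn, hn'] at a2
  rw [hm, hm', hn, hn'] at a3
  have b1 : |m - m'| < 2 := by exact_mod_cast a1
  have b2 : |n - n'| < 2 := by exact_mod_cast a2
  have b3 : |(m + n) - (m' + n')| < 2 := by exact_mod_cast a3
  rw [abs_sub_lt_iff] at b1 b2 b3
  -- Both vertices lie in one sublattice, so `m - m'` and `n - n'` are congruent modulo `3`. As
  -- elements of `{-1, 0, 1}` they are equal, and the bound on their sum leaves only `0`.
  have e : m = m' ∧ n = n' := by omega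
  exact ext_coords (by rw [hm, hm', e.1]) (by rw [hn, hn', e.2])

/-- The centroid of a scaled triangle. -/
def Triangle.center (T : Triangle) (ε : ℝ) : Plane :=
  (ε / 3) • (T.vertex 0 + T.vertex 1 + T.vertex 2)

-- The edge vectors have determinant `±1` in lattice coordinates, so barycentric coordinates are
-- explicit. Radius `1 / 24` gives lattice coordinates at most `1 / 12` and weight corrections at
-- most `1 / 6`; the least weight is at least `1 / 3 - 1 / 6 - 1 / 6 = 0`.
set_option maxHeartbeats 400000 in
theorem Triangle.ball_subset_hull (T : Triangle) {ε : ℝ} (hε : 0 < ε) :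
    Metric.ball (T.center ε) (ε / 24) ⊆ T.hull ε := by
  intro x hx
  set y : Plane := ε⁻¹ • (x - T.center ε) with hy
  have hxy : x = T.center ε + ε • y := by
    rw [hy, smul_smul, mul_inv_cancel₀ hε.ne', one_smul]; abel
  have hyn : ‖y‖ ≤ 1 / 24 := by
    rw [Metric.mem_ball, dist_eq_norm] at hx
    rw [hy, norm_smul, norm_inv, Real.norm_eq_abs, abs_of_pos hε, inv_mul_le_iff₀ hε]
    linarith
  have h01 := T.norm_sub_sq (α := 1) (β := 0) (by decide)
  have h02 := T.norm_sub_sq (α := 2) (β := 0) (by decide)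
  have h12 := T.norm_sub_sq (α := 2) (β := 1) (by decide)
  have hA1 := (T.abs_coord_sub_le 0 1).1
  have hB1 := (T.abs_coord_sub_le 0 1).2.1
  have hA2 := (T.abs_coord_sub_le 0 2).1
  have hB2 := (T.abs_coord_sub_le 0 2).2.1
  rw [norm_sq_lattice_coord, map_sub, map_sub] at h01 h02 h12
  set p := coordA (T.vertex 1) - coordA (T.vertex 0) with hp
  set q := coordB (T.vertex 1) - coordB (T.vertex 0) with hq
  set p' := coordA (T.vertex 2) - coordA (T.vertex 0) with hp'
  set q' := coordB (T.vertex 2) - coordB (T.vertex 0) with hq'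
  rw [show coordA (T.vertex 2) - coordA (T.vertex 1) = p' - p by rw [hp, hp']; ring,
    show coordB (T.vertex 2) - coordB (T.vertex 1) = q' - q by rw [hq, hq']; ring] at h12
  set D := p * q' - p' * q with hD
  have hB : 2 * p * p' + p * q' + p' * q + 2 * q * q' = 1 := by nlinarith
  have hD2 : D * D = 1 := by
    -- The Gram determinant of the two edges: unit lengths and inner product `1 / 2` give `4 - 1 = 3
    -- D ^ 2`.
    have hid : 4 * ((p ^ 2 + p * q + q ^ 2) * (p' ^ 2 + p' * q' + q' ^ 2))
        - (2 * p * p' + p * q' + p' * q + 2 * q * q') ^ 2 = 3 * (D * D) := by rw [hD]; ring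
    rw [h01, h02, hB] at hid
    linarith
  have hDa : |D| = 1 := (abs_eq zero_le_one).2 (mul_self_eq_one_iff.1 hD2)
  have ha : |coordA y| ≤ 1 / 12 := (abs_coordA_le y).trans (by linarith)
  have hb : |coordB y| ≤ 1 / 12 := (abs_coordB_le y).trans (by linarith)
  set a := coordA y with ha'
  set b := coordB y with hb'
  have bound : ∀ s t : ℝ, |s| ≤ 1 → |t| ≤ 1 → |D * (a * s - b * t)| ≤ 1 / 6 := by
    intro s t hs ht
    rw [abs_mul, hDa, one_mul]
    refine (abs_sub _ _).trans ?_
    rw [abs_mul, abs_mul]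
    have e1 : |a| * |s| ≤ 1 / 12 * 1 := mul_le_mul ha hs (abs_nonneg _) (by norm_num)
    have e2 : |b| * |t| ≤ 1 / 12 * 1 := mul_le_mul hb ht (abs_nonneg _) (by norm_num)
    linarith
  have hl1 := bound q' p' hB2 hA2
  have hl2 := bound q p hB1 hA1
  set l1 := D * (a * q' - b * p') with hl1'
  set l2 := D * (a * q - b * p) with hl2'
  rw [abs_le] at hl1 hl2
  have hyl : y = l1 • (T.vertex 1 - T.vertex 0) - l2 • (T.vertex 2 - T.vertex 0) := by
    apply ext_coords
    · simp only [map_sub, map_smul, smul_eq_mul, ← hp, ← hp', ← ha']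
      rw [hl1', hl2']
      have : D * (a * q' - b * p') * p - D * (a * q - b * p) * p' = a * (D * D) := by rw [hD]; ring
      rw [this, hD2, mul_one]
    · simp only [map_sub, map_smul, smul_eq_mul, ← hq, ← hq', ← hb']
      rw [hl1', hl2']
      have : D * (a * q' - b * p') * q - D * (a * q - b * p) * q' = b * (D * D) := by rw [hD]; ring
      rw [this, hD2, mul_one]
  have hx' : x = ∑ α : Fin 3, ![1 / 3 - l1 + l2, 1 / 3 + l1, 1 / 3 - l2] α • (ε • T.vertex α) := by
    rw [hxy, hyl, Triangle.center, Fin.sum_univ_three]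
    simp only [Matrix.cons_val_zero, Matrix.cons_val_one, Matrix.cons_val]
    module
  rw [hx', Triangle.hull]
  refine (convex_convexHull ℝ _).sum_mem ?_ ?_ fun α _ => subset_convexHull ℝ _ ⟨α, rfl⟩
  · intro α _
    fin_cases α <;> simp <;> linarith
  · rw [Fin.sum_univ_three]
    simp only [Matrix.cons_val_zero, Matrix.cons_val_one, Matrix.cons_val]
    ring

theorem Triangle.ball_subset_interior (T : Triangle) {ε : ℝ} (hε : 0 < ε) :
    Metric.ball (T.center ε) (ε / 24) ⊆ interior (T.hull ε) :=
  interior_maximal (T.ball_subset_hull hε) Metric.isOpen_ball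

theorem Triangle.dist_hull_le (T : Triangle) {ε : ℝ} (hε : 0 < ε) (α : Fin 3) :
    ∀ x ∈ T.hull ε, dist x (ε • T.vertex α) ≤ ε := by
  have : T.hull ε ⊆ Metric.closedBall (ε • T.vertex α) ε := by
    refine convexHull_min ?_ (convex_closedBall _ _)
    rintro _ ⟨β, rfl⟩
    have := T.dist_le β α
    rw [Metric.mem_closedBall, dist_smul₀, Real.norm_eq_abs, abs_of_pos hε]
    nlinarith
  exact this

theorem pairwise_disjoint_balls {ε : ℝ} (hε : 0 < ε) :
    Pairwise (Function.onFun Disjoint fun T : Triangle => Metric.ball (T.center ε) (ε / 24)) := by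
  intro T T' hne
  rw [Function.onFun, Set.disjoint_left]
  intro x hx hx'
  exact hne (Triangle.eq_of_mem_interior hε (T.ball_subset_interior hε hx)
    (T'.ball_subset_interior hε hx'))

theorem volume_ball_ge (x : Plane) {ε : ℝ} (hε : 0 < ε) :
    ENNReal.ofReal (ε ^ 2 / 200) ≤ volume (Metric.ball x (ε / 24)) := by
  rw [EuclideanSpace.volume_ball_fin_two, ← ENNReal.ofReal_pow (by positivity),
    ← NNReal.coe_real_pi, ← ENNReal.ofReal_mul (by positivity)]
  apply ENNReal.ofReal_le_ofReal
  have := Real.pi_gt_three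
  rw [NNReal.coe_real_pi]
  nlinarith [sq_nonneg ε]

/-- The packing bound in terms of a set of points covered by pairwise disjoint balls. -/
theorem card_mul_le_volume_iUnion {ε : ℝ} (hε : 0 < ε) (s : Finset Triangle) :
    ENNReal.ofReal (s.card * (ε ^ 2 / 200))
      ≤ volume (⋃ T ∈ s, Metric.ball (T.center ε) (ε / 24)) := by
  rw [measure_biUnion_finset ((pairwise_disjoint_balls hε).set_pairwise _)
    fun T _ => measurableSet_ball, ENNReal.ofReal_mul (by positivity), ENNReal.ofReal_natCast,
    ← nsmul_eq_mul]
  exact Finset.card_nsmul_le_sum _ _ _ fun T _ => volume_ball_ge _ hε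

/-- Packing: the inscribed balls are pairwise disjoint and each has area at least `1 / 200`. -/
theorem card_le_of_hull_subset (s : Finset Triangle) {A : Set Plane} {a : ℝ}
    (ha : 0 ≤ a) (hA : volume A ≤ ENNReal.ofReal a) (h : ∀ T ∈ s, T.hull 1 ⊆ A) :
    (s.card : ℝ) ≤ 200 * a := by
  have h1 := (card_mul_le_volume_iUnion one_pos s).trans
    ((measure_mono (Set.iUnion₂_subset fun T hT =>
      (T.ball_subset_hull one_pos).trans (h T hT))).trans hA)
  rw [ENNReal.ofReal_le_ofReal_iff ha] at h1
  linarith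

theorem Triangle.dist_le_of_mem_hull_one (T : Triangle) {x : Plane} (hx : x ∈ T.hull 1)
    (α : Fin 3) : dist x (T.vertex α) ≤ 1 := by
  simpa using T.dist_hull_le one_pos α x hx

/-- The number of triangles with a vertex in a rotated rectangle. -/
theorem card_le_of_vertex_mem_rect {ν : Plane} (hν : ‖ν‖ = 1) (s : Finset Triangle) {a b c d : ℝ}
    (hab : a ≤ b) (hcd : c ≤ d)
    (h : ∀ T ∈ s, ∃ α, along ν (T.vertex α) ∈ Set.Icc a b ∧ height ν (T.vertex α) ∈ Set.Icc c d) :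
    (s.card : ℝ) ≤ 200 * ((b - a + 2) * (d - c + 2)) := by
  -- Triangles have diameter one, so they stay in the rectangle enlarged by `1` on each side.
  refine card_le_of_hull_subset s (mul_nonneg (by linarith) (by linarith))
    (A := {x : Plane | along ν x ∈ Set.Icc (a - 1) (b + 1) ∧
      height ν x ∈ Set.Icc (c - 1) (d + 1)}) ?_ ?_
  · rw [volume_rotated_rect hν, ← ENNReal.ofReal_mul (by linarith)]
    apply ENNReal.ofReal_le_ofReal
    apply le_of_eq; ring
  · intro T hT x hx
    obtain ⟨α, ⟨h1, h2⟩, h3, h4⟩ := h T hT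
    have hd := T.dist_le_of_mem_hull_one hx α
    have h5 := abs_le.1 ((abs_along_sub_le hν _ _).trans hd)
    have h6 := abs_le.1 ((abs_height_sub_le hν _ _).trans hd)
    exact ⟨⟨by linarith, by linarith⟩, ⟨by linarith, by linarith⟩⟩

/-! ### The energy in lattice units -/

/-- The open square of half side `R`. -/
def box (ν : Plane) (R : ℝ) : Set Plane := {x | |along ν x| < R ∧ |height ν x| < R}

theorem smul_mem_square_iff {ν : Plane} {ε : ℝ} (hε : 0 < ε) {p : Plane} :
    ε • p ∈ square ν ↔ p ∈ box ν (1 / (2 * ε)) := by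
  have key : ∀ a : ℝ, |ε * a| < 1 / 2 ↔ |a| < 1 / (2 * ε) := by
    intro a
    rw [abs_mul, abs_of_pos hε, lt_div_iff₀ (by positivity), lt_div_iff₀ (by positivity)]
    constructor <;> intro h <;> linarith
  change |inner ℝ (ε • p) (perp ν)| < 1 / 2 ∧ |inner ℝ (ε • p) ν| < 1 / 2 ↔ _
  rw [inner_perp_eq, inner_eq_height, map_smul, map_smul, smul_eq_mul, smul_eq_mul, key, key]
  rfl

theorem convex_square (ν : Plane) : Convex ℝ (square ν) := by
  have : square ν = along ν ⁻¹' Set.Ioo (-(1 / 2)) (1 / 2)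
      ∩ height ν ⁻¹' Set.Ioo (-(1 / 2)) (1 / 2) := by
    ext x
    change |inner ℝ x (perp ν)| < 1 / 2 ∧ |inner ℝ x ν| < 1 / 2 ↔ _
    rw [inner_perp_eq, inner_eq_height, abs_lt, abs_lt]
    rfl
  rw [this]
  exact ((convex_Ioo _ _).linear_preimage (along ν).toLinearMap).inter
    ((convex_Ioo _ _).linear_preimage (height ν).toLinearMap)

theorem isOpen_square (ν : Plane) : IsOpen (square ν) := by
  have : square ν = {x | |along ν x| < 1 / 2} ∩ {x | |height ν x| < 1 / 2} := by
    ext x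
    change |inner ℝ x (perp ν)| < 1 / 2 ∧ |inner ℝ x ν| < 1 / 2 ↔ _
    rw [inner_perp_eq, inner_eq_height]
    rfl
  rw [this]
  exact (isOpen_lt (by fun_prop) continuous_const).inter (isOpen_lt (by fun_prop) continuous_const)

/-- The triangles with all vertices in the open square of half side `R`. -/
def tri (ν : Plane) (R : ℝ) : Set Triangle := {T | ∀ α, T.vertex α ∈ box ν R}

/-- The square is convex, so only the vertices matter. -/
theorem hull_subset_square_iff {ν : Plane} {ε : ℝ} (hε : 0 < ε) {T : Triangle} :
    T.hull ε ⊆ square ν ↔ T ∈ tri ν (1 / (2 * ε)) := by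
  rw [Triangle.hull, (convex_square ν).convexHull_subset_iff, Set.range_subset_iff]
  exact forall_congr' fun α => smul_mem_square_iff hε

theorem tri_finite {ν : Plane} (hν : ‖ν‖ = 1) (R : ℝ) : (tri ν R).Finite := by
  by_contra hinf
  obtain ⟨n, hn⟩ := exists_nat_gt (200 * ((|R| - -|R| + 2) * (|R| - -|R| + 2)))
  obtain ⟨s, hs, hc⟩ := (show (tri ν R).Infinite from hinf).exists_subset_card_eq n
  have hR : -|R| ≤ |R| := by linarith [abs_nonneg R]
  have := card_le_of_vertex_mem_rect hν s hR hR fun T hT => ⟨0, by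
    obtain ⟨h1, h2⟩ := hs hT 0
    exact ⟨abs_le.1 (h1.le.trans (le_abs_self R)), abs_le.1 (h2.le.trans (le_abs_self R))⟩⟩
  rw [hc] at this
  linarith

open Classical in
/-- The triangles in the square, as a finite set. -/
def triF (ν : Plane) (R : ℝ) : Finset Triangle :=
  if h : (tri ν R).Finite then h.toFinset else ∅

theorem coe_triF {ν : Plane} (hν : ‖ν‖ = 1) (R : ℝ) : (triF ν R : Set Triangle) = tri ν R := by
  rw [triF, dif_pos (tri_finite hν R), Set.Finite.coe_toFinset]

theorem mem_triF {ν : Plane} (hν : ‖ν‖ = 1) {R : ℝ} {T : Triangle} :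
    T ∈ triF ν R ↔ ∀ α, T.vertex α ∈ box ν R := by
  rw [← Finset.mem_coe, coe_triF hν]; rfl

/-- The energy of a field on the unit lattice in one triangle. -/
def cost (W : Plane → Circle) (T : Triangle) : ℝ :=
  ‖(W (T.vertex 0) : ℂ) + W (T.vertex 1) + W (T.vertex 2)‖ ^ 2

theorem cost_nonneg (W : Plane → Circle) (T : Triangle) : 0 ≤ cost W T := by
  unfold cost; positivity

theorem cost_le (W : Plane → Circle) (T : Triangle) : cost W T ≤ 9 := by
  have h : ‖(W (T.vertex 0) : ℂ) + W (T.vertex 1) + W (T.vertex 2)‖ ≤ 3 := by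
    refine (norm_add₃_le).trans ?_
    simp only [Circle.norm_coe]
    norm_num
  unfold cost
  nlinarith [norm_nonneg ((W (T.vertex 0) : ℂ) + W (T.vertex 1) + W (T.vertex 2))]

open Classical in
/-- A spin field, transported to the unit lattice and extended to the plane. -/
def SpinField.ext {ε : ℝ} (u : SpinField ε) : Plane → Circle := fun p =>
  if h : ε • p ∈ (ε • lattice : Set Plane) then u ⟨ε • p, h⟩ else 1

/-- The spin field on the scaled lattice given by a field on the plane. -/
def ofUnit (ε : ℝ) (W : Plane → Circle) : SpinField ε := fun x => W (ε⁻¹ • (x : Plane))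

theorem ofUnit_ext {ε : ℝ} (hε : 0 < ε) (W : Plane → Circle) {p : Plane} (hp : p ∈ lattice) :
    (ofUnit ε W).ext p = W p := by
  rw [SpinField.ext, dif_pos (Set.smul_mem_smul_set hp), ofUnit, smul_smul,
    inv_mul_cancel₀ hε.ne', one_smul]

theorem SpinField.ext_vertex {ε : ℝ} (u : SpinField ε) (T : Triangle) (α : Fin 3) :
    (u.ext (T.vertex α) : ℂ) = SpinField.at u T α := by
  rw [SpinField.ext, dif_pos (Set.smul_mem_smul_set (T.mem_lattice α))]; rfl

theorem triangleEnergy_eq {ε : ℝ} (u : SpinField ε) (T : Triangle) :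
    triangleEnergy u T = ε * cost u.ext T := by
  rw [triangleEnergy, cost, u.ext_vertex, u.ext_vertex, u.ext_vertex]

/-- Converts the extended nonnegative sum into a finite real sum, on which all later estimates are
made. -/
theorem energy_square_eq {ν : Plane} (hν : ‖ν‖ = 1) {ε : ℝ} (hε : 0 < ε) (u : SpinField ε) :
    energy u (square ν) = ENNReal.ofReal (ε * ∑ T ∈ triF ν (1 / (2 * ε)), cost u.ext T) := by
  have hset : {T : Triangle | T.hull ε ⊆ square ν} = (triF ν (1 / (2 * ε)) : Set Triangle) := by
    rw [coe_triF hν]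
    ext T
    exact hull_subset_square_iff hε
  have h1 : energy u (square ν) = ∑' T : {T : Triangle | T.hull ε ⊆ square ν},
      ENNReal.ofReal (triangleEnergy u T) := rfl
  rw [h1, hset, Finset.tsum_subtype' (triF ν (1 / (2 * ε)))
    (fun T => ENNReal.ofReal (triangleEnergy u T)), ← ENNReal.ofReal_sum_of_nonneg, Finset.mul_sum]
  · simp only [triangleEnergy_eq]
  · intro T _
    rw [triangleEnergy_eq]
    exact mul_nonneg hε.le (cost_nonneg _ _)

theorem cost_ofUnit {ε : ℝ} (hε : 0 < ε) (W : Plane → Circle) (T : Triangle) :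
    cost (ofUnit ε W).ext T = cost W T := by
  simp only [cost, ofUnit_ext hε W (T.mem_lattice _)]

/-! ### Ground states and boundary data -/

open Classical in
/-- The ground state of chirality `+1` on the unit lattice. -/
def groundPos (p : Plane) : Circle :=
  if p ∈ sublattice 0 then Circle.exp 0
  else if p ∈ sublattice 1 then Circle.exp (2 * Real.pi / 3)
  else Circle.exp (4 * Real.pi / 3)

open Classical in
/-- The ground state of chirality `-1` on the unit lattice. -/
def groundNeg (p : Plane) : Circle :=
  if p ∈ sublattice 0 then Circle.exp 0
  else if p ∈ sublattice 1 then Circle.exp (4 * Real.pi / 3)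
  else Circle.exp (2 * Real.pi / 3)

open Classical in
theorem upos_eq {ε : ℝ} (hε : 0 < ε) (x : (ε • lattice : Set Plane)) :
    upos ε x = groundPos (ε⁻¹ • (x : Plane)) := by
  have h := fun α => Set.mem_smul_set_iff_inv_smul_mem₀ hε.ne' (sublattice α) (x : Plane)
  exact if_congr (h 0) rfl (if_congr (h 1) rfl rfl)

open Classical in
theorem uneg_eq {ε : ℝ} (hε : 0 < ε) (x : (ε • lattice : Set Plane)) :
    uneg ε x = groundNeg (ε⁻¹ • (x : Plane)) := by
  have h := fun α => Set.mem_smul_set_iff_inv_smul_mem₀ hε.ne' (sublattice α) (x : Plane)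
  exact if_congr (h 0) rfl (if_congr (h 1) rfl rfl)

open Classical in
theorem groundPos_add {p t : Plane} (ht : t ∈ sublattice 0) :
    groundPos (p + t) = groundPos p := by
  exact if_congr (add_mem_sublattice_iff ht) rfl (if_congr (add_mem_sublattice_iff ht) rfl rfl)

open Classical in
theorem groundNeg_add {p t : Plane} (ht : t ∈ sublattice 0) :
    groundNeg (p + t) = groundNeg p := by
  exact if_congr (add_mem_sublattice_iff ht) rfl (if_congr (add_mem_sublattice_iff ht) rfl rfl)

theorem groundPos_vertex (T : Triangle) (α : Fin 3) :
    groundPos (T.vertex α) = Circle.exp (![0, 2 * Real.pi / 3, 4 * Real.pi / 3] α) := by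
  have h : ∀ β, T.vertex α ∈ sublattice β ↔ α = β := fun β =>
    ⟨fun h => sublattice_disjoint (T.mem α) h, fun h => h ▸ T.mem α⟩
  simp only [groundPos, h]
  fin_cases α <;> simp

theorem groundNeg_vertex (T : Triangle) (α : Fin 3) :
    groundNeg (T.vertex α) = Circle.exp (![0, 4 * Real.pi / 3, 2 * Real.pi / 3] α) := by
  have h : ∀ β, T.vertex α ∈ sublattice β ↔ α = β := fun β =>
    ⟨fun h => sublattice_disjoint (T.mem α) h, fun h => h ▸ T.mem α⟩
  simp only [groundNeg, h]
  fin_cases α <;> simp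

theorem frontier_square_nonempty {ν : Plane} (hν : ‖ν‖ = 1) : (frontier (square ν)).Nonempty := by
  have h0 : (0 : Plane) ∈ square ν := by
    change |inner ℝ (0 : Plane) (perp ν)| < 1 / 2 ∧ |inner ℝ (0 : Plane) ν| < 1 / 2
    simp
  have h1 : ν ∉ square ν := by
    rintro ⟨-, h⟩
    rw [real_inner_self_eq_norm_sq, hν] at h
    norm_num at h
  exact nonempty_frontier_iff.2 ⟨⟨0, h0⟩, fun h => h1 (h ▸ Set.mem_univ ν)⟩

/-- The segment from `x` to `z` is connected and leaves the square, so it meets the frontier. -/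
theorem infDist_frontier_le {ν : Plane} {x z : Plane} (hx : x ∈ square ν) (hz : z ∉ square ν) :
    Metric.infDist x (frontier (square ν)) ≤ dist x z := by
  obtain ⟨y, hy, hy'⟩ : ∃ y ∈ segment ℝ x z, y ∈ frontier (square ν) := by
    by_contra! hcon
    have hcl : ∀ y ∈ segment ℝ x z, y ∉ square ν → y ∉ closure (square ν) := by
      intro y hy hy1 hy2
      exact hcon y hy (by rw [(isOpen_square ν).frontier_eq]; exact ⟨hy2, hy1⟩)
    obtain ⟨y, -, hy1, hy2⟩ := (convex_segment x z).isPreconnected (square ν)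
      (closure (square ν))ᶜ (isOpen_square ν) isClosed_closure.isOpen_compl
      (fun y hy => by
        by_cases h : y ∈ square ν
        · exact Or.inl h
        · exact Or.inr (hcl y hy h))
      ⟨x, left_mem_segment ℝ x z, hx⟩
      ⟨z, right_mem_segment ℝ x z, hcl z (right_mem_segment ℝ x z) hz⟩
    exact hy2 (subset_closure hy1)
  refine (Metric.infDist_le_dist_of_mem hy').trans ?_
  have := dist_add_dist_of_mem_segment hy
  linarith [dist_nonneg (x := y) (y := z)]

/-- The distance bound `3 * ε` only yields a frontier point at distance below `4 * ε`; this is the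
source of the margin `4` kept by every competitor. -/
theorem notMem_box_of_infDist_le {ν : Plane} (hν : ‖ν‖ = 1) {ε : ℝ} (hε : 0 < ε) {p : Plane}
    (h : Metric.infDist (ε • p) (frontier (square ν)) ≤ 3 * ε) :
    p ∉ box ν (1 / (2 * ε) - 4) := by
  intro hp
  obtain ⟨y, hy, hd⟩ := (Metric.infDist_lt_iff (frontier_square_nonempty hν)).1
    (h.trans_lt (show 3 * ε < 4 * ε by linarith))
  have hy' : y ∉ square ν := by
    rw [(isOpen_square ν).frontier_eq] at hy
    exact hy.2
  apply hy'
  have hyz : y = ε • (ε⁻¹ • y) := by rw [smul_smul, mul_inv_cancel₀ hε.ne', one_smul]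
  set z := ε⁻¹ • y
  rw [hyz, smul_mem_square_iff hε]
  rw [hyz, dist_smul₀, Real.norm_eq_abs, abs_of_pos hε] at hd
  have hd' : dist p z < 4 := by nlinarith
  obtain ⟨h1, h2⟩ := hp
  have a1 := abs_le.1 (abs_along_sub_le hν p z)
  have a2 := abs_le.1 (abs_height_sub_le hν p z)
  rw [abs_lt] at h1 h2
  constructor <;> rw [abs_lt] <;> constructor <;> linarith

/-- A field which is a ground state outside a smaller square attains the boundary data. -/
theorem ofUnit_mem_admissible {ν : Plane} (hν : ‖ν‖ = 1) {ε : ℝ} (hε : 0 < ε)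
    {W : Plane → Circle}
    (hpos : ∀ p, p ∉ box ν (1 / (2 * ε) - 4) → 3 ≤ height ν p → W p = groundPos p)
    (hneg : ∀ p, p ∉ box ν (1 / (2 * ε) - 4) → height ν p ≤ -3 → W p = groundNeg p) :
    ofUnit ε W ∈ admissible ε ν := by
  have hx : ∀ x : Plane, x = ε • (ε⁻¹ • x) := fun x => by
    rw [smul_smul, mul_inv_cancel₀ hε.ne', one_smul]
  constructor
  · rintro x ⟨-, h1, h2⟩
    rw [upos_eq hε]
    rw [hx (x : Plane)] at h2
    refine hpos _ (notMem_box_of_infDist_le hν hε h2) ?_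
    change 3 * ε ≤ height ν x at h1
    rw [map_smul, smul_eq_mul, ← div_eq_inv_mul, le_div_iff₀ hε]
    exact h1
  · rintro x ⟨-, h1, h2⟩
    rw [uneg_eq hε]
    rw [hx (x : Plane)] at h2
    refine hneg _ (notMem_box_of_infDist_le hν hε h2) ?_
    change 3 * ε ≤ -height ν x at h1
    rw [map_smul, smul_eq_mul, ← div_eq_inv_mul, div_le_iff₀ hε]
    linarith

/-- A vertex of a triangle that sticks out of the square is close enough to the frontier to carry
boundary data. This is what makes pasted copies match their surroundings. -/
theorem infDist_smul_le {ν : Plane} {ε : ℝ} (hε : 0 < ε)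
    {p z : Plane} (hp : p ∈ box ν (1 / (2 * ε))) (hz : z ∉ box ν (1 / (2 * ε)))
    (hpz : dist p z ≤ 1) : Metric.infDist (ε • p) (frontier (square ν)) ≤ 3 * ε := by
  refine (infDist_frontier_le ((smul_mem_square_iff hε).2 hp)
    (fun h => hz ((smul_mem_square_iff hε).1 h))).trans ?_
  rw [dist_smul₀, Real.norm_eq_abs, abs_of_pos hε]
  nlinarith

theorem ext_eq_groundPos {ν : Plane} {ε : ℝ} (hε : 0 < ε) {u : SpinField ε}
    (hu : u ∈ admissible ε ν) {p z : Plane} (hl : p ∈ lattice) (hp : p ∈ box ν (1 / (2 * ε)))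
    (hz : z ∉ box ν (1 / (2 * ε))) (hpz : dist p z ≤ 1) (h3 : 3 ≤ height ν p) :
    u.ext p = groundPos p := by
  have hmem := Set.smul_mem_smul_set (a := ε) hl
  have h4 : 3 * ε ≤ height ν (ε • p) := by
    rw [map_smul, smul_eq_mul]
    nlinarith
  have h5 : u ⟨ε • p, hmem⟩ = upos ε ⟨ε • p, hmem⟩ :=
    hu.1 ⟨ε • p, hmem⟩ ⟨hmem, h4, infDist_smul_le hε hp hz hpz⟩
  rw [SpinField.ext, dif_pos hmem, h5, upos_eq hε, smul_smul, inv_mul_cancel₀ hε.ne', one_smul]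

theorem ext_eq_groundNeg {ν : Plane} {ε : ℝ} (hε : 0 < ε) {u : SpinField ε}
    (hu : u ∈ admissible ε ν) {p z : Plane} (hl : p ∈ lattice) (hp : p ∈ box ν (1 / (2 * ε)))
    (hz : z ∉ box ν (1 / (2 * ε))) (hpz : dist p z ≤ 1) (h3 : height ν p ≤ -3) :
    u.ext p = groundNeg p := by
  have hmem := Set.smul_mem_smul_set (a := ε) hl
  have h4 : 3 * ε ≤ -height ν (ε • p) := by
    rw [map_smul, smul_eq_mul]
    nlinarith
  have h5 : u ⟨ε • p, hmem⟩ = uneg ε ⟨ε • p, hmem⟩ :=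
    hu.2 ⟨ε • p, hmem⟩ ⟨hmem, h4, infDist_smul_le hε hp hz hpz⟩
  rw [SpinField.ext, dif_pos hmem, h5, uneg_eq hε, smul_smul, inv_mul_cancel₀ hε.ne', one_smul]

/-! ### Algebra of three unit vectors -/

/-- The primitive third root of unity. -/
def cubeRoot : ℂ := ⟨-1 / 2, √3 / 2⟩

theorem exp_two_pi_div_three : (Circle.exp (2 * Real.pi / 3) : ℂ) = cubeRoot := by
  rw [Circle.coe_exp, Complex.exp_mul_I, ← Complex.ofReal_cos, ← Complex.ofReal_sin]
  have h : 2 * Real.pi / 3 = Real.pi - Real.pi / 3 := by ring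
  rw [h, Real.cos_pi_sub, Real.sin_pi_sub, Real.cos_pi_div_three, Real.sin_pi_div_three]
  apply Complex.ext <;> simp [cubeRoot]; norm_num

theorem exp_four_pi_div_three :
    (Circle.exp (4 * Real.pi / 3) : ℂ) = (starRingEnd ℂ) cubeRoot := by
  rw [Circle.coe_exp, Complex.exp_mul_I, ← Complex.ofReal_cos, ← Complex.ofReal_sin]
  have h : 4 * Real.pi / 3 = Real.pi / 3 + Real.pi := by ring
  rw [h, Real.cos_add_pi, Real.sin_add_pi, Real.cos_pi_div_three, Real.sin_pi_div_three]
  apply Complex.ext <;> simp [cubeRoot]; norm_num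

theorem sq_norm_eq (z : ℂ) : ‖z‖ ^ 2 = z.re ^ 2 + z.im ^ 2 := by
  rw [Complex.sq_norm, Complex.normSq_apply]; ring

theorem re_sq_add_im_sq {z : ℂ} (hz : ‖z‖ = 1) : z.re ^ 2 + z.im ^ 2 = 1 := by
  rw [← sq_norm_eq, hz, one_pow]

theorem sum_sq_norm_sub {a b c : ℂ} (ha : ‖a‖ = 1) (hb : ‖b‖ = 1) (hc : ‖c‖ = 1) :
    ‖a - b‖ ^ 2 + ‖b - c‖ ^ 2 + ‖c - a‖ ^ 2 = 9 - ‖a + b + c‖ ^ 2 := by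
  have h1 := re_sq_add_im_sq ha
  have h2 := re_sq_add_im_sq hb
  have h3 := re_sq_add_im_sq hc
  simp only [sq_norm_eq, Complex.sub_re, Complex.sub_im, Complex.add_re, Complex.add_im]
  linear_combination 3 * h1 + 3 * h2 + 3 * h3

/-- Parseval's identity for the discrete Fourier transform of order three. -/
theorem parseval_three {a b c : ℂ} (ha : ‖a‖ = 1) (hb : ‖b‖ = 1) (hc : ‖c‖ = 1) :
    ‖a + b + c‖ ^ 2 + ‖a + b * cubeRoot + c * (starRingEnd ℂ) cubeRoot‖ ^ 2
      + ‖a + b * (starRingEnd ℂ) cubeRoot + c * cubeRoot‖ ^ 2 = 9 := by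
  have h1 := re_sq_add_im_sq ha
  have h2 := re_sq_add_im_sq hb
  have h3 := re_sq_add_im_sq hc
  have hs : √3 ^ 2 = 3 := Real.sq_sqrt (by norm_num)
  simp only [sq_norm_eq, Complex.add_re, Complex.add_im, Complex.mul_re, Complex.mul_im, cubeRoot,
    Complex.conj_re, Complex.conj_im]
  linear_combination 3 * h1 + 3 * h2 + 3 * h3 + (1 / 2) * ((b.re - c.re) ^ 2 + (b.im - c.im) ^ 2) * hs

/-- The left side is three times `|a|² + ω̄ |b|² + ω |c|²`, with `ω` the cube root of unity. It
vanishes because the three moduli are equal. -/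
theorem fourier_shift_eq_zero {a b c : ℂ} (ha : ‖a‖ = 1) (hb : ‖b‖ = 1) (hc : ‖c‖ = 1) :
    (a + b + c) * (starRingEnd ℂ) (a + b * cubeRoot + c * (starRingEnd ℂ) cubeRoot)
      + (a + b * cubeRoot + c * (starRingEnd ℂ) cubeRoot)
        * (starRingEnd ℂ) (a + b * (starRingEnd ℂ) cubeRoot + c * cubeRoot)
      + (a + b * (starRingEnd ℂ) cubeRoot + c * cubeRoot) * (starRingEnd ℂ) (a + b + c) = 0 := by
  have key : ∀ z : ℂ, ‖z‖ = 1 → z * (starRingEnd ℂ) z = 1 := by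
    intro z hz
    rw [Complex.mul_conj, Complex.normSq_eq_norm_sq, hz]; norm_num
  have h1 := key a ha
  have h2 := key b hb
  have h3 := key c hc
  have hs : √3 ^ 2 = 3 := Real.sq_sqrt (by norm_num)
  have hw : (starRingEnd ℂ) cubeRoot = -1 - cubeRoot := by
    apply Complex.ext <;> simp [cubeRoot]; norm_num
  have hw2 : cubeRoot ^ 2 + cubeRoot + 1 = 0 := by
    apply Complex.ext <;> simp [cubeRoot, sq] <;> nlinarith
  have hw' : (starRingEnd ℂ) (-1 - cubeRoot) = cubeRoot := by rw [← hw, Complex.conj_conj]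
  simp only [map_add, map_mul, hw, hw']
  set a' := (starRingEnd ℂ) a
  set b' := (starRingEnd ℂ) b
  set c' := (starRingEnd ℂ) c
  linear_combination 3 * h1 + 3 * (-1 - cubeRoot) * h2 + 3 * cubeRoot * h3
    + (b * b' - b * c' - c * b' + c * c') * hw2

/-- For three unit vectors of nonnegative chirality, the energy controls the distance from a rotated
ground state. -/
theorem sum_sq_norm_sub_le {a b c : ℂ} (ha : ‖a‖ = 1) (hb : ‖b‖ = 1) (hc : ‖c‖ = 1)
    (h : ‖a + b * (starRingEnd ℂ) cubeRoot + c * cubeRoot‖ ≤ ‖a + b + c‖) :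
    ‖a - b‖ ^ 2 + ‖b - c‖ ^ 2 + ‖c - a‖ ^ 2
      ≤ 5 * ‖a + b * cubeRoot + c * (starRingEnd ℂ) cubeRoot‖ ^ 2 := by
  have h0 := fourier_shift_eq_zero ha hb hc
  have hp := parseval_three ha hb hc
  rw [sum_sq_norm_sub ha hb hc]
  set A := a + b + c
  set B := a + b * cubeRoot + c * (starRingEnd ℂ) cubeRoot
  set C := a + b * (starRingEnd ℂ) cubeRoot + c * cubeRoot
  have h1 : ‖C‖ * ‖A‖ ≤ ‖A‖ * ‖B‖ + ‖B‖ * ‖C‖ := by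
    have e : C * (starRingEnd ℂ) A = -(A * (starRingEnd ℂ) B + B * (starRingEnd ℂ) C) := by
      linear_combination h0
    calc ‖C‖ * ‖A‖ = ‖C * (starRingEnd ℂ) A‖ := by rw [norm_mul, RCLike.norm_conj]
      _ ≤ ‖A * (starRingEnd ℂ) B‖ + ‖B * (starRingEnd ℂ) C‖ := by
        rw [e, norm_neg]; exact norm_add_le _ _
      _ = _ := by rw [norm_mul, norm_mul, RCLike.norm_conj, RCLike.norm_conj]
  -- From `‖C‖ ≤ ‖A‖` the right side of `h1` is at most `2 ‖A‖ ‖B‖`; cancel `‖A‖`, or note `C = 0`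
  -- when `A = 0`. Then `9 - ‖A‖² = ‖B‖² + ‖C‖² ≤ 5 ‖B‖²`.
  have h2 : ‖C‖ ≤ 2 * ‖B‖ := by
    rcases (norm_nonneg A).eq_or_lt with hA | hA
    · rw [← hA] at h; linarith [norm_nonneg B]
    · by_contra! hlt
      nlinarith [norm_nonneg B, norm_nonneg C]
  nlinarith [norm_nonneg B, norm_nonneg C]

theorem energy_le_sum_sq {a b c : ℂ} (ha : ‖a‖ = 1) (hb : ‖b‖ = 1) (hc : ‖c‖ = 1) :
    ‖a + b * cubeRoot + c * (starRingEnd ℂ) cubeRoot‖ ^ 2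
      ≤ ‖a - b‖ ^ 2 + ‖b - c‖ ^ 2 + ‖c - a‖ ^ 2 := by
  rw [sum_sq_norm_sub ha hb hc, ← parseval_three ha hb hc]
  nlinarith [sq_nonneg ‖a + b * (starRingEnd ℂ) cubeRoot + c * cubeRoot‖]

/-- In terms of phases relative to the positive ground state, the sign of the chirality tells which
of two Fourier coefficients is larger. This supplies the hypothesis of `sum_sq_norm_sub_le`. -/
theorem cross_sum_eq (a b c : ℂ) :
    2 / (3 * √3) * (cross a (b * cubeRoot) + cross (b * cubeRoot) (c * (starRingEnd ℂ) cubeRoot)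
      + cross (c * (starRingEnd ℂ) cubeRoot) a)
      = (‖a + b + c‖ ^ 2 - ‖a + b * (starRingEnd ℂ) cubeRoot + c * cubeRoot‖ ^ 2) / 9 := by
  have hs : √3 ^ 2 = 3 := Real.sq_sqrt (by norm_num)
  have hs' : √3 ≠ 0 := by positivity
  simp only [sq_norm_eq, cross, Complex.add_re, Complex.add_im, Complex.mul_re, Complex.mul_im,
    cubeRoot, Complex.conj_re, Complex.conj_im]
  field_simp
  grind

/-! ### The deviation from the ground states -/

open Classical in
/-- The pure interface: the ground states above and below the line orthogonal to `ν`. -/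
def interface (ν : Plane) (p : Plane) : Circle :=
  if 0 ≤ height ν p then groundPos p else groundNeg p

/-- The quadratic deviation of three phases from each other. -/
def spread (v : Plane → Circle) (T : Triangle) : ℝ :=
  ‖(v (T.vertex 0) : ℂ) - v (T.vertex 1)‖ ^ 2 + ‖(v (T.vertex 1) : ℂ) - v (T.vertex 2)‖ ^ 2
    + ‖(v (T.vertex 2) : ℂ) - v (T.vertex 0)‖ ^ 2

theorem cost_pos_eq {W v : Plane → Circle} {T : Triangle}
    (h : ∀ α, W (T.vertex α) = v (T.vertex α) * groundPos (T.vertex α)) :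
    cost W T = ‖(v (T.vertex 0) : ℂ) + v (T.vertex 1) * cubeRoot
      + v (T.vertex 2) * (starRingEnd ℂ) cubeRoot‖ ^ 2 := by
  simp only [cost, h, groundPos_vertex, Circle.coe_mul, Matrix.cons_val_zero, Matrix.cons_val_one,
    Matrix.cons_val, exp_two_pi_div_three, exp_four_pi_div_three, Circle.exp_zero,
    mul_one]

/-- Exchanging the last two vertices turns the negative ground state into the positive one, so the
same algebra serves both signs. -/
theorem cost_neg_eq {W v : Plane → Circle} {T : Triangle}
    (h : ∀ α, W (T.vertex α) = v (T.vertex α) * groundNeg (T.vertex α)) :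
    cost W T = ‖(v (T.vertex 0) : ℂ) + v (T.vertex 2) * cubeRoot
      + v (T.vertex 1) * (starRingEnd ℂ) cubeRoot‖ ^ 2 := by
  simp only [cost, h, groundNeg_vertex, Circle.coe_mul, Matrix.cons_val_zero, Matrix.cons_val_one,
    Matrix.cons_val, exp_two_pi_div_three, exp_four_pi_div_three, Circle.exp_zero,
    mul_one]
  congr 2; ring

theorem spread_swap (v : Plane → Circle) (T : Triangle) :
    spread v T = ‖(v (T.vertex 0) : ℂ) - v (T.vertex 2)‖ ^ 2
      + ‖(v (T.vertex 2) : ℂ) - v (T.vertex 1)‖ ^ 2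
      + ‖(v (T.vertex 1) : ℂ) - v (T.vertex 0)‖ ^ 2 := by
  rw [spread, norm_sub_rev (v (T.vertex 0) : ℂ) (v (T.vertex 1)),
    norm_sub_rev (v (T.vertex 1) : ℂ) (v (T.vertex 2)),
    norm_sub_rev (v (T.vertex 2) : ℂ) (v (T.vertex 0))]
  ring

theorem cost_le_spread_pos {W v : Plane → Circle} {T : Triangle}
    (h : ∀ α, W (T.vertex α) = v (T.vertex α) * groundPos (T.vertex α)) :
    cost W T ≤ spread v T := by
  rw [cost_pos_eq h]
  exact energy_le_sum_sq (Circle.norm_coe _) (Circle.norm_coe _) (Circle.norm_coe _)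

theorem cost_le_spread_neg {W v : Plane → Circle} {T : Triangle}
    (h : ∀ α, W (T.vertex α) = v (T.vertex α) * groundNeg (T.vertex α)) :
    cost W T ≤ spread v T := by
  rw [cost_neg_eq h, spread_swap]
  exact energy_le_sum_sq (Circle.norm_coe _) (Circle.norm_coe _) (Circle.norm_coe _)

/-- The chirality of a field on the unit lattice in one triangle. -/
def unitChirality (W : Plane → Circle) (T : Triangle) : ℝ :=
  2 / (3 * √3) * (cross (W (T.vertex 0)) (W (T.vertex 1)) + cross (W (T.vertex 1)) (W (T.vertex 2))
    + cross (W (T.vertex 2)) (W (T.vertex 0)))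

theorem triangleChirality_eq {ε : ℝ} (u : SpinField ε) (T : Triangle) :
    triangleChirality u T = unitChirality u.ext T := by
  rw [triangleChirality, unitChirality, u.ext_vertex, u.ext_vertex, u.ext_vertex]

theorem cross_swap (z w : ℂ) : cross z w = -cross w z := by
  unfold cross; ring

theorem spread_le_cost_pos {W v : Plane → Circle} {T : Triangle}
    (h : ∀ α, W (T.vertex α) = v (T.vertex α) * groundPos (T.vertex α))
    (hχ : 0 ≤ unitChirality W T) : spread v T ≤ 5 * cost W T := by
  rw [cost_pos_eq h]
  refine sum_sq_norm_sub_le (Circle.norm_coe _) (Circle.norm_coe _) (Circle.norm_coe _) ?_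
  simp only [unitChirality, h, groundPos_vertex, Circle.coe_mul, Matrix.cons_val_zero,
    Matrix.cons_val_one, Matrix.cons_val, exp_two_pi_div_three, exp_four_pi_div_three,
    Circle.exp_zero, mul_one] at hχ
  rw [cross_sum_eq] at hχ
  exact abs_le_of_sq_le_sq' (by linarith) (norm_nonneg _) |>.2

theorem spread_le_cost_neg {W v : Plane → Circle} {T : Triangle}
    (h : ∀ α, W (T.vertex α) = v (T.vertex α) * groundNeg (T.vertex α))
    (hχ : unitChirality W T ≤ 0) : spread v T ≤ 5 * cost W T := by
  rw [cost_neg_eq h, spread_swap]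
  refine sum_sq_norm_sub_le (Circle.norm_coe _) (Circle.norm_coe _) (Circle.norm_coe _) ?_
  simp only [unitChirality, h, groundNeg_vertex, Circle.coe_mul, Matrix.cons_val_zero,
    Matrix.cons_val_one, Matrix.cons_val, exp_two_pi_div_three, exp_four_pi_div_three,
    Circle.exp_zero, mul_one] at hχ
  have := cross_sum_eq (v (T.vertex 0)) (v (T.vertex 2)) (v (T.vertex 1))
  -- The exchange of vertices reverses the orientation, hence the sign of the chirality.
  rw [cross_swap (v (T.vertex 0) : ℂ), cross_swap (_ * cubeRoot) (_ * (starRingEnd ℂ) cubeRoot),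
    cross_swap (_ * (starRingEnd ℂ) cubeRoot) (v (T.vertex 0))] at this
  refine abs_le_of_sq_le_sq' (?_ : _ ≤ _) (norm_nonneg _) |>.2
  linarith

theorem spread_const {v : Plane → Circle} {T : Triangle} (h : ∀ α, v (T.vertex α) = 1) :
    spread v T = 0 := by
  simp [spread, h]

theorem cost_groundPos {W : Plane → Circle} {T : Triangle}
    (h : ∀ α, W (T.vertex α) = groundPos (T.vertex α)) : cost W T = 0 :=
  le_antisymm ((cost_le_spread_pos (v := fun _ => 1) (by simpa using h)).trans
    (spread_const fun _ => rfl).le) (cost_nonneg _ _)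

theorem cost_groundNeg {W : Plane → Circle} {T : Triangle}
    (h : ∀ α, W (T.vertex α) = groundNeg (T.vertex α)) : cost W T = 0 :=
  le_antisymm ((cost_le_spread_neg (v := fun _ => 1) (by simpa using h)).trans
    (spread_const fun _ => rfl).le) (cost_nonneg _ _)

/-! ### Subadditivity of the cell minima -/

/-- The translate of a triangle by a vector of the first sublattice. -/
def Triangle.shift (T : Triangle) (t : Plane) (ht : t ∈ sublattice 0) : Triangle where
  vertex α := T.vertex α + t
  mem α := add_mem_sublattice (T.mem α) ht
  dist_eq α β h := by rw [dist_add_right]; exact T.dist_eq α β h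

theorem Triangle.shift_injective (t : Plane) (ht : t ∈ sublattice 0) :
    Function.Injective fun T : Triangle => T.shift t ht := by
  intro T T' h
  refine Triangle.ext_vertex fun α => ?_
  have := congrArg (fun T : Triangle => T.vertex α) h
  exact add_right_cancel this

/-- The index of the cell of length `P` containing a point. -/
def cellIndex (ν : Plane) (L P : ℝ) (p : Plane) : ℤ := ⌊(along ν p + L) / P⌋

open Classical in
/-- Copies of a field in translated squares of half side `s / 2`, surrounded by the pure interface. -/
def tiling (ν : Plane) (L P s : ℝ) (n : ℕ) (t : ℤ → Plane) (W : Plane → Circle) (p : Plane) :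
    Circle :=
  if 0 ≤ cellIndex ν L P p ∧ cellIndex ν L P p < n ∧ p - t (cellIndex ν L P p) ∈ box ν (s / 2)
  then W (p - t (cellIndex ν L P p)) else interface ν p

/-- The centre of a cell. -/
def cellCenter (L P : ℝ) (k : ℤ) : ℝ := -L + (k + 1 / 2) * P

theorem cellIndex_bounds {ν : Plane} {L P : ℝ} (hP : 0 < P) (p : Plane) :
    |along ν p - cellCenter L P (cellIndex ν L P p)| ≤ P / 2 := by
  have h1 := Int.floor_le ((along ν p + L) / P)
  have h2 := Int.lt_floor_add_one ((along ν p + L) / P)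
  rw [le_div_iff₀ hP] at h1
  rw [div_lt_iff₀ hP] at h2
  unfold cellCenter cellIndex
  rw [abs_le]
  constructor <;> nlinarith

theorem cellIndex_eq {ν : Plane} {L P : ℝ} (hP : 0 < P) {p : Plane} {k : ℤ}
    (h : |along ν p - cellCenter L P k| < P / 2) : cellIndex ν L P p = k := by
  unfold cellCenter at h
  rw [abs_lt] at h
  rw [cellIndex, Int.floor_eq_iff, le_div_iff₀ hP, div_lt_iff₀ hP]
  constructor <;> nlinarith

section Tiling

variable {ν : Plane} {L s : ℝ} {n : ℕ} {t : ℤ → Plane}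

theorem translate_near (hν : ‖ν‖ = 1) {P : ℝ}
    (htd : ∀ k, dist (t k) (cellCenter L P k • perp ν) ≤ 2) (k : ℤ) :
    |along ν (t k) - cellCenter L P k| ≤ 2 ∧ |height ν (t k)| ≤ 2 := by
  have h1 := (abs_along_sub_le hν _ _).trans (htd k)
  have h2 := (abs_height_sub_le hν _ _).trans (htd k)
  rw [along_smul_perp hν] at h1
  rw [height_smul_perp, sub_zero] at h2
  exact ⟨h1, h2⟩

/-- A copy has half side `s / 2` and its centre is displaced by at most `2`, while the cell has half
length `s / 2 + 6`. So copies lie in their own cells and do not overlap. -/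
theorem cellIndex_eq_of_mem_copy (hν : ‖ν‖ = 1) (hs : 0 < s)
    (htd : ∀ k, dist (t k) (cellCenter L (s + 12) k • perp ν) ≤ 2) {p : Plane} {k : ℤ}
    (hp : p - t k ∈ box ν (s / 2)) : cellIndex ν L (s + 12) p = k := by
  have h1 := (translate_near hν htd k).1
  have h2 := hp.1
  rw [map_sub] at h2
  apply cellIndex_eq (by linarith)
  rw [abs_lt] at *
  rw [abs_le] at h1
  constructor <;> linarith

theorem tiling_of_mem_copy (hν : ‖ν‖ = 1) (hs : 0 < s)
    (htd : ∀ k, dist (t k) (cellCenter L (s + 12) k • perp ν) ≤ 2) (W : Plane → Circle)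
    {p : Plane} {k : ℕ} (hk : k < n) (hp : p - t k ∈ box ν (s / 2)) :
    tiling ν L (s + 12) s n t W p = W (p - t k) := by
  have hi := cellIndex_eq_of_mem_copy hν hs htd hp
  rw [tiling, hi, if_pos]
  exact ⟨by positivity, by exact_mod_cast hk, hp⟩

/-- A triangle contained in no copy carries energy only near the interface. -/
theorem cost_tiling_eq_zero (hν : ‖ν‖ = 1) (ht : ∀ k, t k ∈ sublattice 0)
    (htd : ∀ k, dist (t k) (cellCenter L (s + 12) k • perp ν) ≤ 2) {W : Plane → Circle}
    (hWp : ∀ p z, p ∈ lattice → p ∈ box ν (s / 2) → z ∉ box ν (s / 2) → dist p z ≤ 1 →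
      3 ≤ height ν p → W p = groundPos p)
    (hWn : ∀ p z, p ∈ lattice → p ∈ box ν (s / 2) → z ∉ box ν (s / 2) → dist p z ≤ 1 →
      height ν p ≤ -3 → W p = groundNeg p)
    {T : Triangle} (hT : ∀ k : ℕ, k < n → ∃ β, T.vertex β - t k ∉ box ν (s / 2))
    (hc : cost (tiling ν L (s + 12) s n t W) T ≠ 0) : |height ν (T.vertex 0)| ≤ 6 := by
  by_contra! hlt
  have hd : ∀ α, |height ν (T.vertex α) - height ν (T.vertex 0)| ≤ 1 := fun α =>
    (abs_height_sub_le hν _ _).trans (T.dist_le _ _)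
  have hlat : ∀ α k, T.vertex α - t k ∈ lattice := fun α k => by
    rw [sub_eq_add_neg]
    exact sublattice_subset α (add_mem_sublattice (T.mem α) (neg_mem_sublattice_zero (ht k)))
  apply hc
  rcases lt_abs.1 hlt with h | h
  · refine cost_groundPos fun α => ?_
    have h1 := abs_le.1 (hd α)
    rw [tiling]
    -- Inside a copy, some vertex `β` is outside it, so the boundary data apply at the vertex `α`.
    -- The threshold `6` is `3` from the data, `2` from the translation and `1` from the triangle.
    split_ifs with hi
    · obtain ⟨h0, hn, hb⟩ := hi
      lift cellIndex ν L (s + 12) (T.vertex α) to ℕ using h0 with k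
      obtain ⟨β, hβ⟩ := hT k (by exact_mod_cast hn)
      have h2 := abs_le.1 (translate_near hν htd k).2
      rw [hWp _ _ (hlat α k) hb hβ (by rw [dist_sub_right]; exact T.dist_le α β)
        (by rw [map_sub]; linarith), ← groundPos_add (ht k), sub_add_cancel]
    · rw [interface, if_pos (by linarith)]
  · refine cost_groundNeg fun α => ?_
    have h1 := abs_le.1 (hd α)
    rw [tiling]
    split_ifs with hi
    · obtain ⟨h0, hn, hb⟩ := hi
      lift cellIndex ν L (s + 12) (T.vertex α) to ℕ using h0 with k
      obtain ⟨β, hβ⟩ := hT k (by exact_mod_cast hn)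
      have h2 := abs_le.1 (translate_near hν htd k).2
      rw [hWn _ _ (hlat α k) hb hβ (by rw [dist_sub_right]; exact T.dist_le α β)
        (by rw [map_sub]; linarith), ← groundNeg_add (ht k), sub_add_cancel]
    · rw [interface, if_neg (by linarith)]

/-- A triangle near the interface which is contained in no copy lies in a gap between the copies, or
in the rest at the end. -/
theorem gap_position (hν : ‖ν‖ = 1) (hs : 20 < s)
    (htd : ∀ k, dist (t k) (cellCenter L (s + 12) k • perp ν) ≤ 2)
    (hn : 2 * L < (n + 1) * (s + 12))
    {T : Triangle} (hT : ∀ k : ℕ, k < n → ∃ β, T.vertex β - t k ∉ box ν (s / 2))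
    (hb : T.vertex 0 ∈ box ν L) (hh : |height ν (T.vertex 0)| ≤ 6) :
    (∃ j ∈ Finset.range (n + 1), along ν (T.vertex 0) ∈
      Set.Icc (-L + j * (s + 12) - 9) (-L + j * (s + 12) + 9)) ∨
    along ν (T.vertex 0) ∈ Set.Icc (-L + n * (s + 12)) L := by
  have hP : 0 < s + 12 := by linarith
  have hi := cellIndex_bounds (ν := ν) (L := L) hP (T.vertex 0)
  have hb1 := abs_lt.1 hb.1
  have h0 : 0 ≤ cellIndex ν L (s + 12) (T.vertex 0) :=
    Int.floor_nonneg.2 (div_nonneg (by linarith) hP.le)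
  lift cellIndex ν L (s + 12) (T.vertex 0) to ℕ using h0 with k
  have hi' := abs_le.1 hi
  simp only [cellCenter, Int.cast_natCast] at hi'
  have hkn : k ≤ n := by
    by_contra! hlt
    have : ((n : ℝ) + 1) ≤ k := by exact_mod_cast hlt
    nlinarith
  rcases hkn.lt_or_eq with hk | rfl
  · left
    -- Within this range the whole triangle would lie in the copy: `3` pays for the translation and
    -- the diameter, and `s > 20` leaves room for heights up to `9`. Otherwise the distance to a
    -- cell end is at most `(s + 12) / 2 - (s / 2 - 3) = 9`.
    by_cases hc : |along ν (T.vertex 0) - cellCenter L (s + 12) k| < s / 2 - 3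
    · exfalso
      obtain ⟨β, hβ⟩ := hT k hk
      apply hβ
      obtain ⟨h1, h2⟩ := translate_near hν htd k
      have h3 := abs_le.1 ((abs_along_sub_le hν _ _).trans (T.dist_le β 0))
      have h4 := abs_le.1 ((abs_height_sub_le hν _ _).trans (T.dist_le β 0))
      rw [abs_lt] at hc
      rw [abs_le] at h1 h2 hh
      constructor <;> rw [map_sub, abs_lt] <;> constructor <;> linarith
    · rw [not_lt, le_abs] at hc
      simp only [cellCenter, Int.cast_natCast] at hc
      rcases hc with hc | hc
      · refine ⟨k + 1, Finset.mem_range.2 (by omega), ?_, ?_⟩ <;> push_cast <;> linarith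
      · refine ⟨k, Finset.mem_range.2 (by omega), ?_, ?_⟩ <;> linarith
  · right
    exact ⟨by linarith, hb1.2.le⟩

-- Each of the `n + 1` gaps lies in an `18 × 12` rectangle, which gives `200 * 20 * 14 = 56000`
-- triangles; the rest at the end is shorter than one cell.
open Classical in
theorem card_gap_le (hν : ‖ν‖ = 1) (hs : 20 < s)
    (htd : ∀ k, dist (t k) (cellCenter L (s + 12) k • perp ν) ≤ 2)
    (hn : 2 * L < (n + 1) * (s + 12)) (hn' : n * (s + 12) ≤ 2 * L)
    (G : Finset Triangle)
    (hT : ∀ T ∈ G, ∀ k : ℕ, k < n → ∃ β, T.vertex β - t k ∉ box ν (s / 2))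
    (hb : ∀ T ∈ G, T.vertex 0 ∈ box ν L) (hh : ∀ T ∈ G, |height ν (T.vertex 0)| ≤ 6) :
    (G.card : ℝ) ≤ 56000 * (n + 1) + 2800 * (s + 14) := by
  set f : ℕ → Finset Triangle := fun j => G.filter fun T => along ν (T.vertex 0) ∈
      Set.Icc (-L + j * (s + 12) - 9) (-L + j * (s + 12) + 9) with hf
  set g : Finset Triangle := G.filter fun T => along ν (T.vertex 0) ∈
      Set.Icc (-L + n * (s + 12)) L with hg
  have hsub : G ⊆ (Finset.range (n + 1)).biUnion f ∪ g := by
    intro T hTG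
    rw [Finset.mem_union, Finset.mem_biUnion]
    rcases gap_position hν hs htd hn (hT T hTG) (hb T hTG) (hh T hTG) with ⟨j, hj, h⟩ | h
    · exact Or.inl ⟨j, hj, Finset.mem_filter.2 ⟨hTG, h⟩⟩
    · exact Or.inr (Finset.mem_filter.2 ⟨hTG, h⟩)
  have hfc : ∀ j ∈ Finset.range (n + 1), ((f j).card : ℝ) ≤ 56000 := by
    intro j _
    have := card_le_of_vertex_mem_rect hν (f j) (a := -L + j * (s + 12) - 9)
      (b := -L + j * (s + 12) + 9) (c := -6) (d := 6) (by linarith) (by norm_num)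
      fun T hT' => ⟨0, (Finset.mem_filter.1 hT').2,
        abs_le.1 (hh T (Finset.mem_filter.1 hT').1)⟩
    linarith
  have hgc : (g.card : ℝ) ≤ 2800 * (s + 14) := by
    have := card_le_of_vertex_mem_rect hν g (a := -L + n * (s + 12)) (b := L) (c := -6) (d := 6)
      (by linarith) (by norm_num)
      fun T hT' => ⟨0, (Finset.mem_filter.1 hT').2,
        abs_le.1 (hh T (Finset.mem_filter.1 hT').1)⟩
    linarith
  have h1 : (G.card : ℝ) ≤ ((∑ j ∈ Finset.range (n + 1), (f j).card + g.card : ℕ) : ℝ) := by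
    exact_mod_cast (Finset.card_le_card hsub).trans ((Finset.card_union_le _ _).trans
      (Nat.add_le_add_right Finset.card_biUnion_le _))
  have h2 : ∑ j ∈ Finset.range (n + 1), ((f j).card : ℝ) ≤ 56000 * (n + 1) := by
    refine (Finset.sum_le_sum hfc).trans ?_
    rw [Finset.sum_const, Finset.card_range, nsmul_eq_mul]
    push_cast; linarith
  push_cast at h1
  linarith

-- Translation by `-t k` maps the triangles of the copy injectively to triangles of the original
-- square, with the same cost.
open Classical in
theorem sum_copy_le (hν : ‖ν‖ = 1) (hs : 0 < s) (ht : ∀ k, t k ∈ sublattice 0)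
    (htd : ∀ k, dist (t k) (cellCenter L (s + 12) k • perp ν) ≤ 2) (W : Plane → Circle)
    {k : ℕ} (hk : k < n) (F : Finset Triangle)
    (hF : ∀ T ∈ F, ∀ α, T.vertex α - t k ∈ box ν (s / 2)) :
    ∑ T ∈ F, cost (tiling ν L (s + 12) s n t W) T ≤ ∑ T ∈ triF ν (s / 2), cost W T := by
  have htk := neg_mem_sublattice_zero (ht k)
  have h1 : ∀ T ∈ F, cost (tiling ν L (s + 12) s n t W) T = cost W (T.shift (-t k) htk) := by
    intro T hT
    simp only [cost, Triangle.shift, tiling_of_mem_copy hν hs htd W hk (hF T hT _),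
      sub_eq_add_neg]
  rw [Finset.sum_congr rfl h1,
    ← Finset.sum_image (f := cost W) (g := fun T : Triangle => T.shift (-t k) htk)
      (fun T _ T' _ h => Triangle.shift_injective _ htk h)]
  refine Finset.sum_le_sum_of_subset_of_nonneg ?_ fun T _ _ => cost_nonneg _ _
  intro T hT
  obtain ⟨T', hT', rfl⟩ := Finset.mem_image.1 hT
  refine (mem_triF hν).2 fun α => ?_
  have := hF T' hT' α
  rwa [sub_eq_add_neg] at this

-- Every triangle of positive cost lies in some copy or is counted by `card_gap_le`, where its cost
-- is at most `9`.
open Classical in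
theorem sum_tiling_le (hν : ‖ν‖ = 1) (hs : 20 < s) (ht : ∀ k, t k ∈ sublattice 0)
    (htd : ∀ k, dist (t k) (cellCenter L (s + 12) k • perp ν) ≤ 2)
    (hn : 2 * L < (n + 1) * (s + 12)) (hn' : n * (s + 12) ≤ 2 * L) {W : Plane → Circle}
    (hWp : ∀ p z, p ∈ lattice → p ∈ box ν (s / 2) → z ∉ box ν (s / 2) → dist p z ≤ 1 →
      3 ≤ height ν p → W p = groundPos p)
    (hWn : ∀ p z, p ∈ lattice → p ∈ box ν (s / 2) → z ∉ box ν (s / 2) → dist p z ≤ 1 →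
      height ν p ≤ -3 → W p = groundNeg p) :
    ∑ T ∈ triF ν L, cost (tiling ν L (s + 12) s n t W) T
      ≤ n * ∑ T ∈ triF ν (s / 2), cost W T + 9 * (56000 * (n + 1) + 2800 * (s + 14)) := by
  set c := cost (tiling ν L (s + 12) s n t W) with hc
  set F : ℕ → Finset Triangle := fun k => (triF ν L).filter fun T =>
    ∀ α, T.vertex α - t k ∈ box ν (s / 2) with hF
  set G : Finset Triangle := (triF ν L).filter fun T =>
    (∀ k : ℕ, k < n → ∃ β, T.vertex β - t k ∉ box ν (s / 2)) ∧ c T ≠ 0 with hG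
  have hG' : ∑ T ∈ G, c T ≤ 9 * (56000 * (n + 1) + 2800 * (s + 14)) := by
    have h1 : ∑ T ∈ G, c T ≤ ∑ T ∈ G, 9 := Finset.sum_le_sum fun T _ => cost_le _ _
    rw [Finset.sum_const, nsmul_eq_mul] at h1
    have h2 := card_gap_le (n := n) hν hs htd hn hn' G
      (fun T hT => (Finset.mem_filter.1 hT).2.1)
      (fun T hT => (mem_triF hν).1 (Finset.mem_filter.1 hT).1 0)
      (fun T hT => cost_tiling_eq_zero hν ht htd hWp hWn (Finset.mem_filter.1 hT).2.1
        (Finset.mem_filter.1 hT).2.2)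
    linarith
  have hF' : ∑ k ∈ Finset.range n, ∑ T ∈ F k, c T ≤ n * ∑ T ∈ triF ν (s / 2), cost W T := by
    have : ∀ k ∈ Finset.range n, ∑ T ∈ F k, c T ≤ ∑ T ∈ triF ν (s / 2), cost W T := fun k hk =>
      sum_copy_le hν (by linarith) ht htd W (Finset.mem_range.1 hk) (F k)
        fun T hT => (Finset.mem_filter.1 hT).2
    refine (Finset.sum_le_sum this).trans ?_
    rw [Finset.sum_const, Finset.card_range, nsmul_eq_mul]
  have hpt : ∀ T ∈ triF ν L, c T ≤ ∑ k ∈ Finset.range n, (if ∀ α, T.vertex α - t k ∈ box ν (s / 2)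
      then c T else 0) + (if (∀ k : ℕ, k < n → ∃ β, T.vertex β - t k ∉ box ν (s / 2)) ∧ c T ≠ 0
        then c T else 0) := by
    intro T _
    have hc0 : 0 ≤ c T := cost_nonneg _ _
    have hnn : ∀ k ∈ Finset.range n, 0 ≤ (if ∀ α, T.vertex α - t k ∈ box ν (s / 2)
        then c T else 0) := fun k _ => by split_ifs <;> simp [hc0]
    by_cases h : ∀ k : ℕ, k < n → ∃ β, T.vertex β - t k ∉ box ν (s / 2)
    · have h1 := Finset.sum_nonneg hnn
      by_cases h0 : c T = 0
      · rw [if_neg (by tauto)]; linarith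
      · rw [if_pos ⟨h, h0⟩]; linarith
    · rw [if_neg (by tauto), add_zero]
      push Not at h
      obtain ⟨k, hk, hk'⟩ := h
      refine le_trans ?_ (Finset.single_le_sum hnn (Finset.mem_range.2 hk))
      rw [if_pos hk']
  calc ∑ T ∈ triF ν L, c T ≤ _ := Finset.sum_le_sum hpt
    _ = ∑ k ∈ Finset.range n, ∑ T ∈ F k, c T + ∑ T ∈ G, c T := by
      rw [Finset.sum_add_distrib, Finset.sum_comm, hG, Finset.sum_filter]
      congr 1
      refine Finset.sum_congr rfl fun k _ => ?_
      rw [hF, Finset.sum_filter]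
    _ ≤ _ := by linarith

end Tiling

/-! ### Existence and finiteness of the limit of the cell minima -/

theorem cellMin_le_energy {ν : Plane} {ε : ℝ} {u : SpinField ε} (hu : u ∈ admissible ε ν) :
    cellMin ε ν ≤ energy u (square ν) := iInf₂_le u hu

theorem interface_pos {ν p : Plane} (h : 3 ≤ height ν p) : interface ν p = groundPos p := by
  rw [interface, if_pos (by linarith)]

theorem interface_neg {ν p : Plane} (h : height ν p ≤ -3) : interface ν p = groundNeg p := by
  rw [interface, if_neg (by linarith)]

/-- The comparison of cell minima at different scales. -/
theorem cellMin_le_add {ν : Plane} (hν : ‖ν‖ = 1) {ε η : ℝ} (hε : 0 < ε) (hε' : ε ≤ 1 / 40)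
    (hη : 0 < η) (hη' : η ≤ ε / 2) :
    cellMin η ν ≤ cellMin ε ν + ENNReal.ofReal (1000000 * (ε + η / ε)) := by
  rw [← tsub_le_iff_right]
  refine le_iInf₂ fun u hu => ?_
  rw [tsub_le_iff_right]
  set s := 1 / ε with hs
  set L := 1 / (2 * η) with hL
  have hs2 : s / 2 = 1 / (2 * ε) := by rw [hs]; field_simp
  have hs40 : 40 ≤ s := by rw [hs, le_div_iff₀ hε]; linarith
  have hLs : s ≤ L := by
    rw [hs, hL]
    exact one_div_le_one_div_of_le (by linarith) (by linarith)
  have hηL : 2 * L * η = 1 := by rw [hL]; field_simp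
  have hεs : s * ε = 1 := by rw [hs]; field_simp
  have hP : 0 < s + 12 := by linarith
  set n := ⌊2 * L / (s + 12)⌋₊ with hn
  have hn1 : n * (s + 12) ≤ 2 * L := by
    rw [← le_div_iff₀ hP]; exact Nat.floor_le (by positivity)
  have hn2 : 2 * L < (n + 1) * (s + 12) := by
    rw [← div_lt_iff₀ hP]; exact Nat.lt_floor_add_one _
  choose t ht htd using fun k : ℤ => exists_sublattice_zero_near (cellCenter L (s + 12) k • perp ν)
  set W' := tiling ν L (s + 12) s n t u.ext with hW'
  -- Along the interface the cell leaves `6` beside the copy and the translation uses `2`; across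
  -- it, `s / 2 + 2 ≤ L - 4` because `40 ≤ s ≤ L`.
  have hout : ∀ p, p ∉ box ν (L - 4) → W' p = interface ν p := by
    intro p hp
    rw [hW', tiling, if_neg]
    rintro ⟨h0, h1, h2⟩
    apply hp
    obtain ⟨h3, h4⟩ := translate_near hν htd (cellIndex ν L (s + 12) p)
    generalize cellIndex ν L (s + 12) p = k at *
    have h0' : (0 : ℝ) ≤ k := by exact_mod_cast h0
    have h1' : (k : ℝ) + 1 ≤ n := by exact_mod_cast h1
    obtain ⟨h5, h6⟩ := h2
    rw [map_sub] at h5 h6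
    unfold cellCenter at h3
    rw [abs_lt] at h5 h6
    rw [abs_le] at h3 h4
    have h7 : 0 ≤ (k : ℝ) * (s + 12) := by positivity
    have h8 : ((k : ℝ) + 1) * (s + 12) ≤ n * (s + 12) := by gcongr
    constructor <;> rw [abs_lt] <;> constructor <;> linarith
  have hadm : ofUnit η W' ∈ admissible η ν := by
    refine ofUnit_mem_admissible hν hη (fun p hp h => ?_) fun p hp h => ?_
    · rw [hout p hp, interface_pos h]
    · rw [hout p hp, interface_neg h]
  refine (cellMin_le_energy hadm).trans ?_
  have hsum := sum_tiling_le (n := n) (W := u.ext) hν (by linarith) ht htd hn2 hn1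
    (fun p z h1 h2 h3 h4 h5 => by
      rw [hs2] at h2 h3; exact ext_eq_groundPos hε hu h1 h2 h3 h4 h5)
    (fun p z h1 h2 h3 h4 h5 => by
      rw [hs2] at h2 h3; exact ext_eq_groundNeg hε hu h1 h2 h3 h4 h5)
  rw [energy_square_eq hν hη, energy_square_eq hν hε, ← ENNReal.ofReal_add
    (mul_nonneg hε.le (Finset.sum_nonneg fun T _ => cost_nonneg _ _)) (by positivity)]
  apply ENNReal.ofReal_le_ofReal
  simp only [cost_ofUnit hη]
  rw [← hs2]
  set E := ∑ T ∈ triF ν (s / 2), cost u.ext T with hE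
  have hE0 : 0 ≤ E := Finset.sum_nonneg fun T _ => cost_nonneg _ _
  -- The `n` copies together cost no more than the original: the factor `η * n` is at most the old
  -- factor `ε`.
  have hηn : η * n ≤ ε := by
    have h1 : η * n * s ≤ 1 := by
      have : η * n * s ≤ η * (n * (s + 12)) := by
        rw [mul_assoc]; gcongr; linarith
      nlinarith
    calc η * n = (η * n * s) * ε := by rw [mul_assoc, hεs, mul_one]
      _ ≤ 1 * ε := by gcongr
      _ = ε := one_mul _
  have h1 := mul_le_mul_of_nonneg_left hsum hη.le
  have h2 : η * n * E ≤ ε * E := by gcongr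
  have h3 : η / ε = η * s := by rw [hs]; ring
  rw [h3]
  have h4 : η ≤ η * s := by nlinarith
  nlinarith

theorem limsup_cellMin_le {ν : Plane} (hν : ‖ν‖ = 1) {ε : ℝ} (hε : 0 < ε) (hε' : ε ≤ 1 / 40) :
    limsup (fun η => cellMin η ν) (𝓝[>] 0) ≤ cellMin ε ν + ENNReal.ofReal (1000000 * ε) := by
  have h1 : ∀ᶠ η in 𝓝[>] (0 : ℝ),
      cellMin η ν ≤ cellMin ε ν + ENNReal.ofReal (1000000 * (ε + η / ε)) := by
    filter_upwards [Ioo_mem_nhdsGT (show (0 : ℝ) < ε / 2 by linarith)] with η hη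
    exact cellMin_le_add hν hε hε' hη.1 hη.2.le
  refine (limsup_le_limsup h1).trans (le_of_eq ?_)
  refine Tendsto.limsup_eq ?_
  refine Tendsto.const_add _ (ENNReal.tendsto_ofReal ?_)
  have : Continuous fun η : ℝ => 1000000 * (ε + η / ε) := by fun_prop
  have h := this.tendsto 0
  simp only [zero_div, add_zero] at h
  exact h.mono_left nhdsWithin_le_nhds

/-- For fixed `ε` the limit `η → 0` leaves an error linear in `ε`, which then vanishes. -/
theorem limsup_cellMin_le_liminf {ν : Plane} (hν : ‖ν‖ = 1) :
    limsup (fun η => cellMin η ν) (𝓝[>] 0) ≤ liminf (fun η => cellMin η ν) (𝓝[>] 0) := by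
  refine ENNReal.le_of_forall_pos_le_add fun δ hδ _ => ?_
  rw [← tsub_le_iff_right]
  refine le_liminf_of_le (by isBoundedDefault) ?_
  have hδ' : (0 : ℝ) < min (1 / 40 : ℝ) ((δ : ℝ) / 1000000) := by positivity
  filter_upwards [Ioo_mem_nhdsGT hδ'] with ε hε
  rw [tsub_le_iff_right]
  refine (limsup_cellMin_le hν hε.1 (hε.2.le.trans (min_le_left _ _))).trans ?_
  gcongr
  rw [← ENNReal.ofReal_coe_nnreal]
  apply ENNReal.ofReal_le_ofReal
  have := hε.2.le.trans (min_le_right _ _)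
  rw [le_div_iff₀ (by norm_num)] at this
  linarith

theorem tendsto_cellMin {ν : Plane} (hν : ‖ν‖ = 1) :
    Tendsto (fun ε => cellMin ε ν) (𝓝[>] (0 : ℝ)) (𝓝 (phi ν)) := by
  have h := tendsto_of_le_liminf_of_limsup_le (le_refl _) (limsup_cellMin_le_liminf hν)
  rw [phi, h.limUnder_eq]
  exact h

theorem cellMin_lt_top {ν : Plane} (hν : ‖ν‖ = 1) {ε : ℝ} (hε : 0 < ε) : cellMin ε ν < ⊤ := by
  have hadm : ofUnit ε (interface ν) ∈ admissible ε ν :=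
    ofUnit_mem_admissible hν hε (fun _ _ h => interface_pos h) fun _ _ h => interface_neg h
  refine (cellMin_le_energy hadm).trans_lt ?_
  rw [energy_square_eq hν hε]
  exact ENNReal.ofReal_lt_top

theorem phi_lt_top {ν : Plane} (hν : ‖ν‖ = 1) : phi ν < ⊤ := by
  rw [← (tendsto_cellMin hν).limsup_eq]
  refine (limsup_cellMin_le hν (show (0 : ℝ) < 1 / 40 by norm_num) le_rfl).trans_lt ?_
  exact ENNReal.add_lt_top.2 ⟨cellMin_lt_top hν (by norm_num), ENNReal.ofReal_lt_top⟩

/-! ### Angles with a movable cut -/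

open Classical in
/-- The angle of a unit vector, with the cut at the angle `φ`. -/
def cutArg (φ : ℝ) (z : Circle) : ℝ :=
  Complex.arg z + if Complex.arg z < φ then 2 * Real.pi else 0

theorem exp_cutArg (φ : ℝ) (z : Circle) : Circle.exp (cutArg φ z) = z := by
  rw [cutArg]
  split_ifs
  · rw [Circle.exp_add, Circle.exp_arg, Circle.exp_two_pi, mul_one]
  · rw [add_zero, Circle.exp_arg]

theorem abs_cutArg_le (φ : ℝ) (z : Circle) : |cutArg φ z| ≤ 3 * Real.pi := by
  have h1 := Complex.neg_pi_lt_arg (z : ℂ)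
  have h2 := Complex.arg_le_pi (z : ℂ)
  have := Real.pi_pos
  rw [cutArg, abs_le]
  split_ifs <;> constructor <;> linarith

theorem norm_exp_sub_exp_eq (x y : ℝ) :
    ‖(Circle.exp x : ℂ) - Circle.exp y‖ = 2 * |Real.sin ((x - y) / 2)| := by
  have h : (Circle.exp x : ℂ) - Circle.exp y
      = Circle.exp y * (Complex.exp (Complex.I * ((x - y : ℝ) : ℂ)) - 1) := by
    rw [Circle.coe_exp, Circle.coe_exp, mul_sub, mul_one, ← Complex.exp_add]
    congr 2
    push_cast; ring
  rw [h, norm_mul, Circle.norm_coe, one_mul, Complex.norm_exp_I_mul_ofReal_sub_one, norm_mul]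
  simp

theorem norm_exp_sub_exp_le (x y : ℝ) : ‖(Circle.exp x : ℂ) - Circle.exp y‖ ≤ |x - y| := by
  rw [norm_exp_sub_exp_eq]
  have := Real.abs_sin_le_abs (x := (x - y) / 2)
  rw [abs_div, abs_two] at this
  linarith

/-- Jordan's inequality on the first half of the interval, reflected to the second. It is later used
at half the angle difference, where the sine is half the chord. -/
theorem mul_pi_sub_le_sin {x : ℝ} (h0 : 0 ≤ x) (h1 : x ≤ Real.pi) :
    2 * x * (Real.pi - x) ≤ Real.pi ^ 2 * Real.sin x := by
  have key : ∀ y : ℝ, 0 ≤ y → y ≤ Real.pi / 2 →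
      2 * y * (Real.pi - y) ≤ Real.pi ^ 2 * Real.sin y := by
    intro y hy0 hy1
    have h := Real.mul_le_sin hy0 hy1
    have hp := Real.pi_pos
    calc 2 * y * (Real.pi - y) ≤ 2 * y * Real.pi := by gcongr; linarith
      _ = Real.pi ^ 2 * (2 / Real.pi * y) := by field_simp
      _ ≤ _ := by gcongr
  rcases le_total x (Real.pi / 2) with h | h
  · exact key x h0 h
  · have := key (Real.pi - x) (by linarith) (by linarith)
    rw [Real.sin_pi_sub] at this
    linarith

-- The cut separates the two points exactly when it falls between their arguments. The difference
-- `Δ` of the arguments is then replaced by `2π - Δ`, and `(2π - Δ)² - Δ² = 4π (π - Δ)`.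
open Classical in
theorem cutArg_sub_sq_of_le {z w : Circle} (h : Complex.arg z ≤ Complex.arg w) (φ : ℝ) :
    (cutArg φ z - cutArg φ w) ^ 2 = (Complex.arg w - Complex.arg z) ^ 2
      + (Set.Ioc (Complex.arg z) (Complex.arg w)).indicator
        (fun _ => 4 * Real.pi * (Real.pi - (Complex.arg w - Complex.arg z))) φ := by
  rw [cutArg, cutArg, Set.indicator_apply]
  by_cases h1 : Complex.arg z < φ <;> by_cases h2 : Complex.arg w < φ
  · rw [if_pos h1, if_pos h2, if_neg (fun hm => absurd hm.2 (not_le.2 h2))]; ring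
  · rw [if_pos h1, if_neg h2, if_pos ⟨h1, not_lt.1 h2⟩]; ring
  · exact absurd (h.trans_lt h2) h1
  · rw [if_neg h1, if_neg h2, if_neg (fun hm => h1 hm.1)]; ring

/-- The integral equals `2π Δ (2π - Δ)`. It is linear in `Δ` for nearby points, since a proportion
`Δ / 2π` of the cuts separates them; the factor `2π - Δ` matches the chord closing up again as `Δ`
approaches `2π`. -/
theorem integral_cutArg_of_le {z w : Circle} (h : Complex.arg z ≤ Complex.arg w) :
    IntegrableOn (fun φ => (cutArg φ z - cutArg φ w) ^ 2) (Set.Ioc (-Real.pi) Real.pi) ∧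
    ∫ φ in Set.Ioc (-Real.pi) Real.pi, (cutArg φ z - cutArg φ w) ^ 2
      ≤ 2 * Real.pi * (10 * ‖(z : ℂ) - w‖) := by
  have hz1 := Complex.neg_pi_lt_arg (z : ℂ)
  have hw2 := Complex.arg_le_pi (w : ℂ)
  have hpi := Real.pi_pos
  have hnorm : ‖(z : ℂ) - w‖ = 2 * Real.sin ((Complex.arg w - Complex.arg z) / 2) := by
    have := norm_exp_sub_exp_eq (Complex.arg z) (Complex.arg w)
    rw [Circle.exp_arg, Circle.exp_arg] at this
    rw [this, ← abs_neg, ← Real.sin_neg,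
      show -((Complex.arg (z : ℂ) - Complex.arg w) / 2) = (Complex.arg w - Complex.arg z) / 2 by ring,
      abs_of_nonneg (Real.sin_nonneg_of_nonneg_of_le_pi (by linarith) (by linarith))]
  have hsin := mul_pi_sub_le_sin (x := (Complex.arg (w : ℂ) - Complex.arg z) / 2) (by linarith)
    (by linarith)
  have hs0 : 0 ≤ Real.sin ((Complex.arg (w : ℂ) - Complex.arg z) / 2) :=
    Real.sin_nonneg_of_nonneg_of_le_pi (by linarith) (by linarith)
  have heq := cutArg_sub_sq_of_le h
  simp only [heq]
  set Δ := Complex.arg (w : ℂ) - Complex.arg z with hΔ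
  have hi1 : IntegrableOn (fun _ : ℝ => Δ ^ 2) (Set.Ioc (-Real.pi) Real.pi) :=
    integrableOn_const (by simp)
  have hi2 : IntegrableOn ((Set.Ioc (Complex.arg (z : ℂ)) (Complex.arg w)).indicator
      fun _ : ℝ => 4 * Real.pi * (Real.pi - Δ)) (Set.Ioc (-Real.pi) Real.pi) :=
    IntegrableOn.indicator (integrableOn_const (by simp)) measurableSet_Ioc
  refine ⟨hi1.add hi2, ?_⟩
  rw [integral_add hi1 hi2, setIntegral_indicator measurableSet_Ioc,
    Set.inter_eq_self_of_subset_right (Set.Ioc_subset_Ioc hz1.le hw2), setIntegral_const,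
    setIntegral_const, hnorm]
  simp only [measureReal_def, Real.volume_Ioc, smul_eq_mul]
  rw [ENNReal.toReal_ofReal (by linarith), ENNReal.toReal_ofReal (by linarith), ← hΔ]
  have hpi2 : Real.pi ^ 2 ≤ 10 := by
    have := Real.pi_lt_d2
    nlinarith
  have h1 : Δ * (2 * Real.pi - Δ) ≤ 10 * (2 * Real.sin (Δ / 2)) := by
    have := mul_le_mul_of_nonneg_right hpi2 hs0
    linarith
  have h2 := mul_le_mul_of_nonneg_left h1 (show 0 ≤ 2 * Real.pi by positivity)
  linarith

theorem integral_cutArg (z w : Circle) :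
    IntegrableOn (fun φ => (cutArg φ z - cutArg φ w) ^ 2) (Set.Ioc (-Real.pi) Real.pi) ∧
    ∫ φ in Set.Ioc (-Real.pi) Real.pi, (cutArg φ z - cutArg φ w) ^ 2
      ≤ 2 * Real.pi * (10 * ‖(z : ℂ) - w‖) := by
  rcases le_total (Complex.arg (z : ℂ)) (Complex.arg w) with h | h
  · exact integral_cutArg_of_le h
  · have := integral_cutArg_of_le h
    rw [norm_sub_rev]
    simpa only [sub_sq_comm] using this

/-- The quadratic deviation of the three angles with cut at `φ`. -/
def cutSpread (φ : ℝ) (v : Plane → Circle) (T : Triangle) : ℝ :=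
  (cutArg φ (v (T.vertex 0)) - cutArg φ (v (T.vertex 1))) ^ 2
    + (cutArg φ (v (T.vertex 1)) - cutArg φ (v (T.vertex 2))) ^ 2
    + (cutArg φ (v (T.vertex 2)) - cutArg φ (v (T.vertex 0))) ^ 2

/-- Trades the linear bound for the quadratic one which the energy controls; the loss `1 / K ^ 2` is
harmless because a layer is only `K` wide. -/
theorem le_inv_sq_add {K d : ℝ} (hK : 0 < K) : d ≤ 1 / K ^ 2 + K ^ 2 * d ^ 2 := by
  have h1 : (1 / K) * (K * d) = d := by field_simp
  have h2 : 1 / K ^ 2 + K ^ 2 * d ^ 2 = (1 / K) ^ 2 + (K * d) ^ 2 := by ring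
  rw [h2]
  nlinarith [sq_nonneg (1 / K - K * d), sq_nonneg (1 / K), sq_nonneg (K * d)]

/-- Some cut is crossed rarely. -/
theorem exists_cut (S : Finset Triangle) (v : Plane → Circle) {K : ℝ} (hK : 0 < K) :
    ∃ φ, ∑ T ∈ S, cutSpread φ v T ≤ ∑ T ∈ S, (30 / K ^ 2 + 10 * K ^ 2 * spread v T) := by
  have hpi := Real.pi_pos
  have hintegrable : ∀ T : Triangle, IntegrableOn (fun φ => cutSpread φ v T)
      (Set.Ioc (-Real.pi) Real.pi) := fun T =>
    ((integral_cutArg _ _).1.add (integral_cutArg _ _).1).add (integral_cutArg _ _).1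
  have hle : ∀ T : Triangle, ∫ φ in Set.Ioc (-Real.pi) Real.pi, cutSpread φ v T
      ≤ 2 * Real.pi * (30 / K ^ 2 + 10 * K ^ 2 * spread v T) := by
    intro T
    obtain ⟨i1, h1⟩ := integral_cutArg (v (T.vertex 0)) (v (T.vertex 1))
    obtain ⟨i2, h2⟩ := integral_cutArg (v (T.vertex 1)) (v (T.vertex 2))
    obtain ⟨i3, h3⟩ := integral_cutArg (v (T.vertex 2)) (v (T.vertex 0))
    have e : ∫ φ in Set.Ioc (-Real.pi) Real.pi, cutSpread φ v T = _ :=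
      integral_add (i1.add i2) i3
    rw [e, integral_add i1 i2]
    have d1 := le_inv_sq_add (d := ‖(v (T.vertex 0) : ℂ) - v (T.vertex 1)‖) hK
    have d2 := le_inv_sq_add (d := ‖(v (T.vertex 1) : ℂ) - v (T.vertex 2)‖) hK
    have d3 := le_inv_sq_add (d := ‖(v (T.vertex 2) : ℂ) - v (T.vertex 0)‖) hK
    have hsum : 10 * (‖(v (T.vertex 0) : ℂ) - v (T.vertex 1)‖
        + ‖(v (T.vertex 1) : ℂ) - v (T.vertex 2)‖ + ‖(v (T.vertex 2) : ℂ) - v (T.vertex 0)‖)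
        ≤ 30 / K ^ 2 + 10 * K ^ 2 * spread v T := by
      have : 30 / K ^ 2 = 30 * (1 / K ^ 2) := by ring
      rw [this, spread]
      linarith
    have := mul_le_mul_of_nonneg_left hsum (show 0 ≤ 2 * Real.pi by positivity)
    linarith
  have hvol : (volume : Measure ℝ) (Set.Ioc (-Real.pi) Real.pi) = ENNReal.ofReal (2 * Real.pi) := by
    rw [Real.volume_Ioc]; congr 1; ring
  -- One cut must serve all triangles at once, so the sum is averaged before the cut is chosen.
  obtain ⟨φ, -, hφ⟩ := exists_le_setAverage (μ := volume) (s := Set.Ioc (-Real.pi) Real.pi)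
    (f := fun φ => ∑ T ∈ S, cutSpread φ v T) (by rw [hvol]; simpa using hpi)
    (by rw [hvol]; exact ENNReal.ofReal_ne_top) (integrable_finsetSum _ fun T _ => hintegrable T)
  refine ⟨φ, hφ.trans ?_⟩
  rw [setAverage_eq, measureReal_def, hvol, ENNReal.toReal_ofReal (by positivity), smul_eq_mul,
    integral_finsetSum _ fun T _ => hintegrable T, inv_mul_le_iff₀ (by positivity), Finset.mul_sum]
  exact Finset.sum_le_sum fun T _ => hle T

/-! ### Changing a field near the boundary -/

/-- The distance of a point of the square from its boundary. -/
def depth (ν : Plane) (R : ℝ) (p : Plane) : ℝ := R - max |along ν p| |height ν p|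

theorem depth_sub_le {ν : Plane} (hν : ‖ν‖ = 1) (R : ℝ) (p q : Plane) :
    |depth ν R p - depth ν R q| ≤ dist p q := by
  have h1 := abs_le.1 ((abs_abs_sub_abs_le _ _).trans (abs_along_sub_le hν p q))
  have h2 := abs_le.1 ((abs_abs_sub_abs_le _ _).trans (abs_height_sub_le hν p q))
  unfold depth
  rw [abs_le]
  constructor
  · rcases max_choice |along ν p| |height ν p| with h | h <;> rw [h]
    · linarith [le_max_left |along ν q| |height ν q|]
    · linarith [le_max_right |along ν q| |height ν q|]
  · rcases max_choice |along ν q| |height ν q| with h | h <;> rw [h]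
    · linarith [le_max_left |along ν p| |height ν p|]
    · linarith [le_max_right |along ν p| |height ν p|]

/-- The cut-off between the depths `4 + r K` and `4 + (r + 1) K`. -/
def cutoff (ν : Plane) (R K : ℝ) (r : ℕ) (p : Plane) : ℝ :=
  max 0 (min 1 ((depth ν R p - 4) / K - r))

theorem cutoff_nonneg (ν : Plane) (R K : ℝ) (r : ℕ) (p : Plane) : 0 ≤ cutoff ν R K r p :=
  le_max_left _ _

theorem cutoff_le_one (ν : Plane) (R K : ℝ) (r : ℕ) (p : Plane) : cutoff ν R K r p ≤ 1 :=
  max_le zero_le_one (min_le_left _ _)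

theorem cutoff_sub_le {ν : Plane} (hν : ‖ν‖ = 1) (R : ℝ) {K : ℝ} (hK : 0 < K) (r : ℕ)
    {p q : Plane} (hpq : dist p q ≤ 1) : |cutoff ν R K r p - cutoff ν R K r q| ≤ 1 / K := by
  have h1 := (depth_sub_le hν R p q).trans hpq
  refine (abs_max_sub_max_le_max _ _ _ _).trans (max_le (by simp [hK.le]) ?_)
  refine (abs_min_sub_min_le_max _ _ _ _).trans (max_le (by simp [hK.le]) ?_)
  rw [show (depth ν R p - 4) / K - r - ((depth ν R q - 4) / K - r)
    = (depth ν R p - depth ν R q) / K by ring, abs_div, abs_of_pos hK]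
  gcongr

theorem depth_lt_of_cutoff_ne_one {ν : Plane} {R K : ℝ} (hK : 0 < K) {r : ℕ} {p : Plane}
    (h : cutoff ν R K r p ≠ 1) : depth ν R p < 4 + (r + 1) * K := by
  by_contra! hle
  apply h
  have : 1 ≤ (depth ν R p - 4) / K - r := by
    rw [le_sub_iff_add_le, le_div_iff₀ hK]; linarith
  rw [cutoff, min_eq_left this, max_eq_right zero_le_one]

theorem lt_depth_of_cutoff_ne_zero {ν : Plane} {R K : ℝ} (hK : 0 < K) {r : ℕ} {p : Plane}
    (h : cutoff ν R K r p ≠ 0) : 4 + r * K < depth ν R p := by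
  by_contra! hle
  apply h
  have : (depth ν R p - 4) / K - r ≤ 0 := by
    rw [sub_nonpos, div_le_iff₀ hK]; linarith
  rw [cutoff, max_eq_left ((min_le_right _ _).trans this)]

/-- The phase of a field relative to the pure interface. -/
def phase (ν : Plane) (W : Plane → Circle) (p : Plane) : Circle := W p / interface ν p

/-- A field whose phase is damped by the factor `η`. -/
def damped (ν : Plane) (φ : ℝ) (η : Plane → ℝ) (W : Plane → Circle) (p : Plane) : Circle :=
  Circle.exp (η p * cutArg φ (phase ν W p)) * interface ν p

theorem damped_of_eq_one {ν : Plane} {φ : ℝ} {η : Plane → ℝ} {W : Plane → Circle} {p : Plane}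
    (h : η p = 1) : damped ν φ η W p = W p := by
  rw [damped, h, one_mul, exp_cutArg, phase, div_mul_cancel]

theorem damped_of_eq_zero {ν : Plane} {φ : ℝ} {η : Plane → ℝ} {W : Plane → Circle} {p : Plane}
    (h : η p = 0) : damped ν φ η W p = interface ν p := by
  rw [damped, h, zero_mul, Circle.exp_zero, one_mul]

/-- All vertices above the line orthogonal to `ν`. -/
def Triangle.IsUpper (T : Triangle) (ν : Plane) : Prop := ∀ α, 0 ≤ height ν (T.vertex α)

/-- All vertices below the line orthogonal to `ν`. -/
def Triangle.IsLower (T : Triangle) (ν : Plane) : Prop := ∀ α, height ν (T.vertex α) < 0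

/-- The chirality has the wrong sign. -/
def Triangle.IsBad (T : Triangle) (ν : Plane) (W : Plane → Circle) : Prop :=
  T.IsUpper ν ∧ unitChirality W T < 0 ∨ T.IsLower ν ∧ 0 < unitChirality W T

theorem Triangle.IsUpper.interface_eq {T : Triangle} {ν : Plane} (h : T.IsUpper ν) (α : Fin 3) :
    interface ν (T.vertex α) = groundPos (T.vertex α) := by
  rw [interface, if_pos (h α)]

theorem Triangle.IsLower.interface_eq {T : Triangle} {ν : Plane} (h : T.IsLower ν) (α : Fin 3) :
    interface ν (T.vertex α) = groundNeg (T.vertex α) := by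
  rw [interface, if_neg (not_le.2 (h α))]

theorem spread_phase_le {T : Triangle} {ν : Plane} {W : Plane → Circle}
    (h : T.IsUpper ν ∨ T.IsLower ν) (hb : ¬T.IsBad ν W) :
    spread (phase ν W) T ≤ 5 * cost W T := by
  rw [Triangle.IsBad, not_or, not_and, not_and, not_lt, not_lt] at hb
  rcases h with h | h
  · refine spread_le_cost_pos (fun α => ?_) (hb.1 h)
    rw [← h.interface_eq, phase, div_mul_cancel]
  · refine spread_le_cost_neg (fun α => ?_) (hb.2 h)
    rw [← h.interface_eq, phase, div_mul_cancel]

theorem cost_interface_eq_zero {T : Triangle} {ν : Plane} {W : Plane → Circle}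
    (h : T.IsUpper ν ∨ T.IsLower ν) (hW : ∀ α, W (T.vertex α) = interface ν (T.vertex α)) :
    cost W T = 0 := by
  rcases h with h | h
  · exact cost_groundPos fun α => by rw [hW, h.interface_eq]
  · exact cost_groundNeg fun α => by rw [hW, h.interface_eq]

theorem cost_damped_le_spread {T : Triangle} {ν : Plane} (φ : ℝ) (η : Plane → ℝ)
    (W : Plane → Circle) (h : T.IsUpper ν ∨ T.IsLower ν) :
    cost (damped ν φ η W) T
      ≤ spread (fun p => Circle.exp (η p * cutArg φ (phase ν W p))) T := by
  rcases h with h | h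
  · exact cost_le_spread_pos fun α => by rw [← h.interface_eq]; rfl
  · exact cost_le_spread_neg fun α => by rw [← h.interface_eq]; rfl

/-- Split `x a - y b = x (a - b) + (x - y) b`. The second term is small because the cut-off varies
slowly and the angle is bounded: `(3π)² ≤ 90`. -/
theorem sq_norm_damped_sub_le {K x y a b : ℝ} (hK : 0 < K) (hx0 : 0 ≤ x) (hx1 : x ≤ 1)
    (hxy : |x - y| ≤ 1 / K) (hb : |b| ≤ 3 * Real.pi) :
    ‖(Circle.exp (x * a) : ℂ) - Circle.exp (y * b)‖ ^ 2 ≤ 2 * (a - b) ^ 2 + 180 / K ^ 2 := by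
  have h1 : ‖(Circle.exp (x * a) : ℂ) - Circle.exp (y * b)‖ ^ 2 ≤ (x * a - y * b) ^ 2 := by
    rw [← sq_abs (x * a - y * b)]
    exact pow_le_pow_left₀ (norm_nonneg _) (norm_exp_sub_exp_le _ _) 2
  have h2 : (x * a - y * b) ^ 2 ≤ 2 * (x * (a - b)) ^ 2 + 2 * ((x - y) * b) ^ 2 := by
    nlinarith [sq_nonneg (x * (a - b) - (x - y) * b)]
  have h3 : (x * (a - b)) ^ 2 ≤ (a - b) ^ 2 := by
    rw [mul_pow]
    have : x ^ 2 ≤ 1 := by nlinarith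
    nlinarith [sq_nonneg (a - b)]
  have h4 : ((x - y) * b) ^ 2 ≤ 90 / K ^ 2 := by
    have hpi := Real.pi_lt_d2
    have hpi0 := Real.pi_pos
    rw [mul_pow, ← sq_abs (x - y), ← sq_abs b]
    have e1 : |x - y| ^ 2 ≤ (1 / K) ^ 2 := pow_le_pow_left₀ (abs_nonneg _) hxy 2
    have e2 : |b| ^ 2 ≤ 90 := by nlinarith [abs_nonneg b]
    calc |x - y| ^ 2 * |b| ^ 2 ≤ (1 / K) ^ 2 * 90 := by gcongr
      _ = 90 / K ^ 2 := by ring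
  have h5 : 180 / K ^ 2 = 2 * (90 / K ^ 2) := by ring
  linarith

theorem cost_damped_le {T : Triangle} {ν : Plane} (hν : ‖ν‖ = 1) (R : ℝ) {K : ℝ} (hK : 0 < K)
    (r : ℕ) (φ : ℝ) (W : Plane → Circle) (h : T.IsUpper ν ∨ T.IsLower ν) :
    cost (damped ν φ (cutoff ν R K r) W) T ≤ 2 * cutSpread φ (phase ν W) T + 540 / K ^ 2 := by
  refine (cost_damped_le_spread φ _ W h).trans ?_
  have key : ∀ α β : Fin 3, _ := fun α β =>
    sq_norm_damped_sub_le (a := cutArg φ (phase ν W (T.vertex α)))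
      (b := cutArg φ (phase ν W (T.vertex β))) hK (cutoff_nonneg ν R K r (T.vertex α))
      (cutoff_le_one ν R K r (T.vertex α)) (cutoff_sub_le hν R hK r (T.dist_le α β))
      (abs_cutArg_le _ _)
  have h5 : 540 / K ^ 2 = 3 * (180 / K ^ 2) := by ring
  rw [spread, cutSpread, h5]
  linarith [key 0 1, key 1 2, key 2 0]

/-- The triangle meets the transition layer of the cut-off. -/
def Triangle.IsActive (T : Triangle) (ν : Plane) (R K : ℝ) (r : ℕ) : Prop :=
  (∃ α, cutoff ν R K r (T.vertex α) ≠ 1) ∧ ∃ α, cutoff ν R K r (T.vertex α) ≠ 0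

/-- The triangle has a vertex of depth less than `D`. -/
def Triangle.InCollar (T : Triangle) (ν : Plane) (R D : ℝ) : Prop :=
  ∃ α, depth ν R (T.vertex α) < D

open Classical in
/-- The change of energy in one triangle. -/
theorem cost_damped_le_add {T : Triangle} {ν : Plane} (hν : ‖ν‖ = 1) (R : ℝ) {K D : ℝ}
    (hK : 0 < K) {r : ℕ} (hr : 4 + (r + 1) * K ≤ D) (φ : ℝ) (W : Plane → Circle) :
    cost (damped ν φ (cutoff ν R K r) W) T ≤ cost W T
      + (if ¬(T.IsUpper ν ∨ T.IsLower ν) ∧ T.InCollar ν R D then 9 else 0)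
      + (if T.IsActive ν R K r ∧ T.IsBad ν W then 9 else 0)
      + (if T.IsActive ν R K r ∧ (T.IsUpper ν ∨ T.IsLower ν) ∧ ¬T.IsBad ν W
          then 2 * cutSpread φ (phase ν W) T + 540 / K ^ 2 else 0) := by
  have hc0 := cost_nonneg W T
  have hcs : 0 ≤ cutSpread φ (phase ν W) T := by unfold cutSpread; positivity
  have i1 : (0 : ℝ) ≤ if ¬(T.IsUpper ν ∨ T.IsLower ν) ∧ T.InCollar ν R D then 9 else 0 := by
    split_ifs <;> norm_num
  have i2 : (0 : ℝ) ≤ if T.IsActive ν R K r ∧ T.IsBad ν W then 9 else 0 := by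
    split_ifs <;> norm_num
  have i3 : (0 : ℝ) ≤ if T.IsActive ν R K r ∧ (T.IsUpper ν ∨ T.IsLower ν) ∧ ¬T.IsBad ν W
      then 2 * cutSpread φ (phase ν W) T + 540 / K ^ 2 else 0 := by
    split_ifs <;> positivity
  by_cases h1 : ∀ α, cutoff ν R K r (T.vertex α) = 1
  · have : cost (damped ν φ (cutoff ν R K r) W) T = cost W T := by
      simp only [cost, damped_of_eq_one (h1 _)]
    linarith
  push Not at h1
  by_cases hs : T.IsUpper ν ∨ T.IsLower ν
  -- Where the cut-off vanishes the field is the pure interface, which costs nothing on a triangle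
  -- lying on one side.
  · by_cases h0 : ∀ α, cutoff ν R K r (T.vertex α) = 0
    · have := cost_interface_eq_zero (W := damped ν φ (cutoff ν R K r) W) hs
        fun α => damped_of_eq_zero (h0 α)
      linarith
    push Not at h0
    by_cases hb : T.IsBad ν W
    · rw [if_pos (⟨⟨h1, h0⟩, hb⟩ : T.IsActive ν R K r ∧ T.IsBad ν W)]
      linarith [cost_le (damped ν φ (cutoff ν R K r) W) T]
    · rw [if_pos (⟨⟨h1, h0⟩, hs, hb⟩ : T.IsActive ν R K r ∧
        (T.IsUpper ν ∨ T.IsLower ν) ∧ ¬T.IsBad ν W)]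
      linarith [cost_damped_le hν R hK r φ W hs]
  · obtain ⟨α, hα⟩ := h1
    rw [if_pos (⟨hs, α, (depth_lt_of_cutoff_ne_one hK hα).trans_le hr⟩ :
      ¬(T.IsUpper ν ∨ T.IsLower ν) ∧ T.InCollar ν R D)]
    linarith [cost_le (damped ν φ (cutoff ν R K r) W) T]

open Classical in
/-- The weight of a triangle in the transition layer. -/
def weight (ν : Plane) (K : ℝ) (W : Plane → Circle) (T : Triangle) : ℝ :=
  (if T.IsBad ν W then 9 else 0) + 600 / K ^ 2 + 100 * K ^ 2 * cost W T

theorem weight_nonneg (ν : Plane) (K : ℝ) (W : Plane → Circle) (T : Triangle) :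
    0 ≤ weight ν K W T := by
  have := cost_nonneg W T
  unfold weight
  split_ifs <;> positivity

open Classical in
/-- For a suitable cut, the energy changes at most by the weight of the transition layer and the
triangles of the collar that cross the interface. -/
theorem exists_damped_sum_le {ν : Plane} (hν : ‖ν‖ = 1) (R : ℝ) {K D : ℝ}
    (hK : 0 < K) {r : ℕ} (hr : 4 + (r + 1) * K ≤ D) (W : Plane → Circle) (F : Finset Triangle) :
    ∃ φ, ∑ T ∈ F, cost (damped ν φ (cutoff ν R K r) W) T ≤ ∑ T ∈ F, cost W T
      + 9 * ((F.filter fun T => ¬(T.IsUpper ν ∨ T.IsLower ν) ∧ T.InCollar ν R D).card : ℝ)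
      + ∑ T ∈ F, if T.IsActive ν R K r then weight ν K W T else 0 := by
  set S := F.filter fun T => T.IsActive ν R K r ∧ (T.IsUpper ν ∨ T.IsLower ν) ∧ ¬T.IsBad ν W
    with hS
  obtain ⟨φ, hφ⟩ := exists_cut S (phase ν W) hK
  refine ⟨φ, (Finset.sum_le_sum fun T _ => cost_damped_le_add hν R hK hr φ W).trans ?_⟩
  have e1 : ∑ T ∈ F, (if ¬(T.IsUpper ν ∨ T.IsLower ν) ∧ T.InCollar ν R D then (9 : ℝ) else 0)
      = 9 * ((F.filter fun T => ¬(T.IsUpper ν ∨ T.IsLower ν) ∧ T.InCollar ν R D).card : ℝ) := by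
    rw [← Finset.sum_filter, Finset.sum_const, nsmul_eq_mul, mul_comm]
  have e3 : ∑ T ∈ F, (if T.IsActive ν R K r ∧ (T.IsUpper ν ∨ T.IsLower ν) ∧ ¬T.IsBad ν W
      then 2 * cutSpread φ (phase ν W) T + 540 / K ^ 2 else 0)
      = ∑ T ∈ S, (2 * cutSpread φ (phase ν W) T + 540 / K ^ 2) := by
    rw [hS, Finset.sum_filter]
  rw [Finset.sum_add_distrib, Finset.sum_add_distrib, Finset.sum_add_distrib, e1, e3, add_assoc]
  gcongr
  have h1 : ∑ T ∈ S, (2 * cutSpread φ (phase ν W) T + 540 / K ^ 2)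
      ≤ ∑ T ∈ S, (600 / K ^ 2 + 100 * K ^ 2 * cost W T) := by
    calc ∑ T ∈ S, (2 * cutSpread φ (phase ν W) T + 540 / K ^ 2)
        = 2 * ∑ T ∈ S, cutSpread φ (phase ν W) T + ∑ T ∈ S, 540 / K ^ 2 := by
          rw [Finset.sum_add_distrib, Finset.mul_sum]
      _ ≤ 2 * ∑ T ∈ S, (30 / K ^ 2 + 10 * K ^ 2 * spread (phase ν W) T)
          + ∑ T ∈ S, 540 / K ^ 2 := by gcongr
      _ = ∑ T ∈ S, (600 / K ^ 2 + 20 * K ^ 2 * spread (phase ν W) T) := by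
          rw [Finset.mul_sum, ← Finset.sum_add_distrib]
          refine Finset.sum_congr rfl fun T _ => ?_
          ring
      _ ≤ _ := by
          refine Finset.sum_le_sum fun T hT => ?_
          obtain ⟨-, -, h2, h3⟩ := Finset.mem_filter.1 hT
          have := mul_le_mul_of_nonneg_left (spread_phase_le h2 h3)
            (show 0 ≤ 20 * K ^ 2 by positivity)
          linarith
  refine (add_le_add_right h1 _).trans ?_
  rw [hS, Finset.sum_filter, ← Finset.sum_add_distrib]
  refine Finset.sum_le_sum fun T _ => ?_
  have hc0 := cost_nonneg W T
  have hp : 0 ≤ 600 / K ^ 2 + 100 * K ^ 2 * cost W T := by positivity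
  unfold weight
  by_cases ha : T.IsActive ν R K r
  · by_cases hb : T.IsBad ν W
    · simp only [ha, hb, true_and, if_true, not_true_eq_false, and_false, if_false]
      linarith
    · simp only [ha, hb, true_and, if_true, not_false_eq_true, and_true, if_false]
      split_ifs <;> linarith
  · simp [ha]

/-! ### Choice of the transition layer -/

theorem Triangle.IsActive.depth_bounds {T : Triangle} {ν : Plane} (hν : ‖ν‖ = 1) {R K : ℝ}
    (hK : 0 < K) {r : ℕ} (h : T.IsActive ν R K r) :
    3 + r * K < depth ν R (T.vertex 0) ∧ depth ν R (T.vertex 0) < 5 + (r + 1) * K := by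
  obtain ⟨⟨α, hα⟩, β, hβ⟩ := h
  have h1 := depth_lt_of_cutoff_ne_one hK hα
  have h2 := lt_depth_of_cutoff_ne_zero hK hβ
  have h3 := abs_le.1 ((depth_sub_le hν R _ _).trans (T.dist_le α 0))
  have h4 := abs_le.1 ((depth_sub_le hν R _ _).trans (T.dist_le β 0))
  constructor <;> linarith

theorem Triangle.IsActive.inCollar {T : Triangle} {ν : Plane} {R K : ℝ}
    (hK : 0 < K) {r J : ℕ} (hr : r < J) (h : T.IsActive ν R K r) :
    T.InCollar ν R (4 + J * K) := by
  obtain ⟨⟨α, hα⟩, -⟩ := h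
  refine ⟨α, (depth_lt_of_cutoff_ne_one hK hα).trans_le ?_⟩
  have : (r : ℝ) + 1 ≤ J := by exact_mod_cast hr
  nlinarith

theorem card_filter_interval_le (s : Finset ℕ) (p : ℕ → Prop) [DecidablePred p] {x : ℝ}
    (h : ∀ r, p r → x < r ∧ (r : ℝ) < x + 2) : (s.filter p).card ≤ 2 := by
  have hsub : s.filter p ⊆ {(⌊x⌋ + 1).toNat, (⌊x⌋ + 2).toNat} := by
    intro r hr
    obtain ⟨h1, h2⟩ := h r (Finset.mem_filter.1 hr).2
    have h3 : ⌊x⌋ < (r : ℤ) := Int.floor_lt.2 (by exact_mod_cast h1)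
    have h4 : (r : ℤ) < ⌊x⌋ + 3 := by
      have := Int.lt_floor_add_one x
      have h5 : (r : ℝ) < ⌊x⌋ + 3 := by linarith
      exact_mod_cast h5
    rw [Finset.mem_insert, Finset.mem_singleton]
    omega
  exact (Finset.card_le_card hsub).trans Finset.card_le_two

-- The active indices lie in an open interval of length `1 + 2 / K`, which is at most `2` because `K
-- ≥ 2`.
open Classical in
theorem card_active_le {T : Triangle} {ν : Plane} (hν : ‖ν‖ = 1) {R K : ℝ} (hK : 2 ≤ K) (J : ℕ) :
    ((Finset.range J).filter fun r => T.IsActive ν R K r).card ≤ 2 := by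
  have hK0 : 0 < K := by linarith
  refine card_filter_interval_le _ _ (x := (depth ν R (T.vertex 0) - 5) / K - 1) fun r hr => ?_
  obtain ⟨h1, h2⟩ := hr.depth_bounds hν hK0
  constructor
  · rw [sub_lt_iff_lt_add, div_lt_iff₀ hK0]; linarith
  · rw [← sub_lt_iff_lt_add, lt_sub_iff_add_lt, lt_div_iff₀ hK0]; linarith

-- Averaging over the `J` layers: each triangle is active in at most two of them, and only if it
-- lies in the collar.
open Classical in
theorem exists_layer {ν : Plane} (hν : ‖ν‖ = 1) {R K : ℝ} (hK : 2 ≤ K) {J : ℕ} (hJ : 0 < J)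
    (F : Finset Triangle) {w : Triangle → ℝ} (hw : ∀ T, 0 ≤ w T) :
    ∃ r < J, ∑ T ∈ F, (if T.IsActive ν R K r then w T else 0)
      ≤ 2 / J * ∑ T ∈ F.filter fun T => T.InCollar ν R (4 + J * K), w T := by
  have hK0 : 0 < K := by linarith
  have hJ0 : (0 : ℝ) < J := by exact_mod_cast hJ
  set S := ∑ T ∈ F.filter fun T => T.InCollar ν R (4 + J * K), w T with hS
  have h : ∑ r ∈ Finset.range J, ∑ T ∈ F, (if T.IsActive ν R K r then w T else 0)
      ≤ ∑ r ∈ Finset.range J, 2 / J * S := by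
    have e : ∑ r ∈ Finset.range J, 2 / J * S = 2 * S := by
      rw [Finset.sum_const, Finset.card_range, nsmul_eq_mul]; field_simp
    rw [e, Finset.sum_comm, hS, Finset.mul_sum, Finset.sum_filter]
    refine Finset.sum_le_sum fun T _ => ?_
    rw [← Finset.sum_filter, Finset.sum_const, nsmul_eq_mul]
    by_cases hc : T.InCollar ν R (4 + J * K)
    · rw [if_pos hc]
      have : (((Finset.range J).filter fun r => T.IsActive ν R K r).card : ℝ) ≤ 2 := by
        exact_mod_cast card_active_le hν hK J
      exact mul_le_mul_of_nonneg_right this (hw T)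
    · rw [if_neg hc, Finset.filter_eq_empty_iff.2]
      · simp
      · intro r hr ha
        exact hc (ha.inCollar hK0 (Finset.mem_range.1 hr))
  obtain ⟨r, hr, hle⟩ := Finset.exists_le_of_sum_le (Finset.nonempty_range_iff.2 hJ.ne') h
  exact ⟨r, Finset.mem_range.1 hr, hle⟩

/-! ### Counting triangles -/

-- The collar is covered by four strips of width `D`, one along each side of the square.
open Classical in
theorem card_collar_le {ν : Plane} (hν : ‖ν‖ = 1) {R D : ℝ} (hR : 0 ≤ R) (hD : 0 ≤ D) :
    (((triF ν R).filter fun T => T.InCollar ν R D).card : ℝ)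
      ≤ 800 * ((D + 2) * (2 * R + 2)) := by
  set F := (triF ν R).filter fun T => T.InCollar ν R D with hF
  set I : Fin 4 → Triangle → Prop := ![
    fun T => ∃ α, along ν (T.vertex α) ∈ Set.Icc (R - D) R ∧ height ν (T.vertex α) ∈ Set.Icc (-R) R,
    fun T => ∃ α, along ν (T.vertex α) ∈ Set.Icc (-R) (-R + D) ∧
      height ν (T.vertex α) ∈ Set.Icc (-R) R,
    fun T => ∃ α, along ν (T.vertex α) ∈ Set.Icc (-R) R ∧ height ν (T.vertex α) ∈ Set.Icc (R - D) R,
    fun T => ∃ α, along ν (T.vertex α) ∈ Set.Icc (-R) R ∧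
      height ν (T.vertex α) ∈ Set.Icc (-R) (-R + D)] with hI
  have hsub : F ⊆ Finset.univ.biUnion fun i => F.filter (I i) := by
    intro T hT
    obtain ⟨hb, α, hα⟩ := Finset.mem_filter.1 hT
    obtain ⟨h1, h2⟩ := (mem_triF hν).1 hb α
    rw [abs_lt] at h1 h2
    unfold depth at hα
    have hm : R - D < max |along ν (T.vertex α)| |height ν (T.vertex α)| := by linarith
    rw [lt_max_iff, lt_abs, lt_abs] at hm
    simp only [Finset.mem_biUnion, Finset.mem_univ, true_and, Finset.mem_filter]
    rcases hm with (h | h) | (h | h)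
    · exact ⟨0, hT, α, ⟨by linarith, by linarith⟩, ⟨by linarith, by linarith⟩⟩
    · exact ⟨1, hT, α, ⟨by linarith, by linarith⟩, ⟨by linarith, by linarith⟩⟩
    · exact ⟨2, hT, α, ⟨by linarith, by linarith⟩, ⟨by linarith, by linarith⟩⟩
    · exact ⟨3, hT, α, ⟨by linarith, by linarith⟩, ⟨by linarith, by linarith⟩⟩
  have hc : ∀ i, ((F.filter (I i)).card : ℝ) ≤ 200 * ((D + 2) * (2 * R + 2)) := by
    intro i
    have hm : ∀ i, ∀ T ∈ F.filter (I i), I i T := fun i T hT => (Finset.mem_filter.1 hT).2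
    fin_cases i
    · refine (card_le_of_vertex_mem_rect hν _ (a := R - D) (b := R) (c := -R) (d := R)
        (by linarith) (by linarith) (hm 0)).trans (le_of_eq ?_)
      ring
    · refine (card_le_of_vertex_mem_rect hν _ (a := -R) (b := -R + D) (c := -R) (d := R)
        (by linarith) (by linarith) (hm 1)).trans (le_of_eq ?_)
      ring
    · refine (card_le_of_vertex_mem_rect hν _ (a := -R) (b := R) (c := R - D) (d := R)
        (by linarith) (by linarith) (hm 2)).trans (le_of_eq ?_)
      ring
    · refine (card_le_of_vertex_mem_rect hν _ (a := -R) (b := R) (c := -R) (d := -R + D)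
        (by linarith) (by linarith) (hm 3)).trans (le_of_eq ?_)
      ring
  have h1 : (F.card : ℝ) ≤ ((∑ i, (F.filter (I i)).card : ℕ) : ℝ) := by
    exact_mod_cast (Finset.card_le_card hsub).trans Finset.card_biUnion_le
  push_cast at h1
  have h2 := Finset.sum_le_sum fun i (_ : i ∈ Finset.univ) => hc i
  rw [Finset.sum_const, Finset.card_univ, Fintype.card_fin, nsmul_eq_mul] at h2
  push_cast at h2
  linarith

theorem Triangle.abs_height_le_one {T : Triangle} {ν : Plane} (hν : ‖ν‖ = 1)
    (h : ¬(T.IsUpper ν ∨ T.IsLower ν)) (α : Fin 3) : |height ν (T.vertex α)| ≤ 1 := by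
  rw [not_or, Triangle.IsUpper, Triangle.IsLower] at h
  push Not at h
  obtain ⟨⟨β, hβ⟩, γ, hγ⟩ := h
  have h1 := abs_le.1 ((abs_height_sub_le hν _ _).trans (T.dist_le α β))
  have h2 := abs_le.1 ((abs_height_sub_le hν _ _).trans (T.dist_le α γ))
  rw [abs_le]
  constructor <;> linarith

-- Crossing triangles have height at most `1 ≤ R - D`, so they are near the boundary only at the two
-- ends of the interface. Their number is therefore independent of `R`.
open Classical in
theorem card_crossing_le {ν : Plane} (hν : ‖ν‖ = 1) {R D : ℝ} (hD : 0 ≤ D) (hDR : D + 1 ≤ R) :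
    (((triF ν R).filter fun T => ¬(T.IsUpper ν ∨ T.IsLower ν) ∧ T.InCollar ν R D).card : ℝ)
      ≤ 1600 * (D + 2) := by
  set F := (triF ν R).filter fun T => ¬(T.IsUpper ν ∨ T.IsLower ν) ∧ T.InCollar ν R D with hF
  set F₁ := F.filter fun T => ∃ α, along ν (T.vertex α) ∈ Set.Icc (R - D) R ∧
    height ν (T.vertex α) ∈ Set.Icc (-1) 1 with hF₁
  set F₂ := F.filter fun T => ∃ α, along ν (T.vertex α) ∈ Set.Icc (-R) (-R + D) ∧
    height ν (T.vertex α) ∈ Set.Icc (-1) 1 with hF₂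
  have hsub : F ⊆ F₁ ∪ F₂ := by
    intro T hT
    obtain ⟨hb, hs, α, hα⟩ := Finset.mem_filter.1 hT
    have h1 := abs_lt.1 ((mem_triF hν).1 hb α).1
    have h2 := Triangle.abs_height_le_one hν hs α
    unfold depth at hα
    have hm : R - D < |along ν (T.vertex α)| := by
      rcases max_choice |along ν (T.vertex α)| |height ν (T.vertex α)| with h | h <;>
        rw [h] at hα <;> linarith
    rw [Finset.mem_union]
    rcases lt_abs.1 hm with h | h
    · exact Or.inl (Finset.mem_filter.2 ⟨hT, α, ⟨by linarith, by linarith⟩, abs_le.1 h2⟩)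
    · exact Or.inr (Finset.mem_filter.2 ⟨hT, α, ⟨by linarith, by linarith⟩, abs_le.1 h2⟩)
  have c1 := card_le_of_vertex_mem_rect hν F₁ (a := R - D) (b := R) (c := -1) (d := 1)
    (by linarith) (by norm_num) fun T hT => (Finset.mem_filter.1 hT).2
  have c2 := card_le_of_vertex_mem_rect hν F₂ (a := -R) (b := -R + D) (c := -1) (d := 1)
    (by linarith) (by norm_num) fun T hT => (Finset.mem_filter.1 hT).2
  have h1 : (F.card : ℝ) ≤ F₁.card + F₂.card := by
    exact_mod_cast (Finset.card_le_card hsub).trans (Finset.card_union_le _ _)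
  linarith

/-! ### Triangles of wrong chirality -/

theorem chirality_eq_of_mem_interior {ε : ℝ} (hε : 0 < ε) (u : SpinField ε) {T : Triangle}
    {x : Plane} (hx : x ∈ interior (T.hull ε)) : chirality u x = unitChirality u.ext T := by
  have h : ∃ T : Triangle, x ∈ interior (T.hull ε) := ⟨T, hx⟩
  rw [chirality, dif_pos h, Triangle.eq_of_mem_interior hε h.choose_spec hx, triangleChirality_eq]

/-- The jump function is constant on the interior of a triangle on one side of the interface, with
value `±1`, and the chirality there has the opposite sign. -/
theorem one_le_enorm_of_isBad {ν : Plane} (hν : ‖ν‖ = 1) {ε : ℝ} (hε : 0 < ε) (u : SpinField ε)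
    {T : Triangle} (hT : T.IsBad ν u.ext) {x : Plane} (hx : x ∈ interior (T.hull ε)) :
    1 ≤ ‖chirality u x - jump ν x‖ₑ := by
  have key : 1 ≤ |chirality u x - jump ν x| := by
    rw [chirality_eq_of_mem_interior hε u hx, jump, inner_eq_height, le_abs]
    rcases hT with ⟨h, hc⟩ | ⟨h, hc⟩
    · have : 0 ≤ height ν x := by
        have := T.map_hull_le (ε := ε) (c := 0) (-height ν) (fun α => by
          rw [neg_apply, map_smul, smul_eq_mul]
          have := mul_nonneg hε.le (h α)
          linarith) x (interior_subset hx)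
        rw [neg_apply] at this
        linarith
      rw [if_pos this]
      right; linarith
    · have : height ν x < 0 := by
        refine lt_of_mem_interior_of_le (d := ν) ?_ (T.map_hull_le (height ν) fun α => ?_) hx
        · rw [← inner_eq_height, real_inner_self_eq_norm_sq, hν]; norm_num
        · rw [map_smul, smul_eq_mul]
          exact (mul_neg_of_pos_of_neg hε (h α)).le
      rw [if_neg (not_le.2 this)]
      left; linarith
  rw [← ofReal_norm, Real.norm_eq_abs]
  exact ENNReal.one_le_ofReal.2 key

open Classical in
/-- The number of triangles of wrong chirality is controlled by the distance in `L¹`. -/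
theorem card_bad_le {ν : Plane} (hν : ‖ν‖ = 1) {ε : ℝ} (hε : 0 < ε) (u : SpinField ε) {τ : ℝ}
    (hτ : 0 ≤ τ) (h : eLpNorm (fun x => chirality u x - jump ν x) 1
      (volume.restrict (rect 1 1 ν)) ≤ ENNReal.ofReal τ) :
    (((triF ν (1 / (2 * ε))).filter fun T => T.IsBad ν u.ext).card : ℝ) * (ε ^ 2 / 200) ≤ τ := by
  set F := (triF ν (1 / (2 * ε))).filter fun T => T.IsBad ν u.ext with hF
  have h1 := card_mul_le_volume_iUnion hε F
  set U := ⋃ T ∈ F, Metric.ball (T.center ε) (ε / 24) with hU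
  have hUm : MeasurableSet U := F.measurableSet_biUnion fun T _ => measurableSet_ball
  have hUs : U ⊆ rect 1 1 ν := Set.iUnion₂_subset fun T hT =>
    (T.ball_subset_hull hε).trans ((hull_subset_square_iff hε).2
      ((mem_triF hν).1 (Finset.mem_filter.1 hT).1))
  rw [← ENNReal.ofReal_le_ofReal_iff hτ]
  refine h1.trans (le_trans ?_ h)
  rw [eLpNorm_one_eq_lintegral_enorm]
  calc volume U = ∫⁻ _ in U, 1 := by rw [setLIntegral_one]
    _ ≤ ∫⁻ x in U, ‖chirality u x - jump ν x‖ₑ := by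
      refine setLIntegral_mono' hUm fun x hx => ?_
      obtain ⟨T, hT, hxT⟩ := Set.mem_iUnion₂.1 hx
      exact one_le_enorm_of_isBad hν hε u (Finset.mem_filter.1 hT).2
        (T.ball_subset_interior hε hxT)
    _ ≤ _ := lintegral_mono_set hUs

/-! ### Attaining the boundary data -/

theorem damped_mem_admissible {ν : Plane} (hν : ‖ν‖ = 1) {ε K : ℝ} (hε : 0 < ε) (hK : 0 < K)
    (r : ℕ) (φ : ℝ) (W : Plane → Circle) :
    ofUnit ε (damped ν φ (cutoff ν (1 / (2 * ε)) K r) W) ∈ admissible ε ν := by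
  have hout : ∀ p, p ∉ box ν (1 / (2 * ε) - 4) →
      damped ν φ (cutoff ν (1 / (2 * ε)) K r) W p = interface ν p := by
    intro p hp
    apply damped_of_eq_zero
    by_contra h0
    have h1 := lt_depth_of_cutoff_ne_zero hK h0
    have h2 : 0 ≤ r * K := by positivity
    unfold depth at h1
    apply hp
    constructor
    · linarith [le_max_left |along ν p| |height ν p|]
    · linarith [le_max_right |along ν p| |height ν p|]
  refine ofUnit_mem_admissible hν hε (fun p hp h => ?_) fun p hp h => ?_
  · rw [hout p hp, interface_pos h]
  · rw [hout p hp, interface_neg h]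

open Classical in
theorem sum_weight_le {ν : Plane} (hν : ‖ν‖ = 1) {R D K : ℝ} (hR : 0 ≤ R) (hD : 0 ≤ D)
    (W : Plane → Circle) :
    ∑ T ∈ (triF ν R).filter fun T => T.InCollar ν R D, weight ν K W T
      ≤ 9 * (((triF ν R).filter fun T => T.IsBad ν W).card : ℝ)
        + 600 / K ^ 2 * (800 * ((D + 2) * (2 * R + 2)))
        + 100 * K ^ 2 * ∑ T ∈ triF ν R, cost W T := by
  set C := (triF ν R).filter fun T => T.InCollar ν R D with hC
  have hCs : C ⊆ triF ν R := Finset.filter_subset _ _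
  unfold weight
  rw [Finset.sum_add_distrib, Finset.sum_add_distrib, Finset.sum_const, nsmul_eq_mul,
    ← Finset.mul_sum]
  have h1 : ∑ T ∈ C, (if T.IsBad ν W then (9 : ℝ) else 0)
      ≤ 9 * (((triF ν R).filter fun T => T.IsBad ν W).card : ℝ) := by
    rw [← Finset.sum_filter, Finset.sum_const, nsmul_eq_mul, mul_comm]
    have : ((C.filter fun T => T.IsBad ν W).card : ℝ)
        ≤ ((triF ν R).filter fun T => T.IsBad ν W).card := by
      exact_mod_cast Finset.card_le_card (Finset.filter_subset_filter _ hCs)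
    linarith
  have h2 : (C.card : ℝ) * (600 / K ^ 2) ≤ 600 / K ^ 2 * (800 * ((D + 2) * (2 * R + 2))) := by
    rw [mul_comm]
    exact mul_le_mul_of_nonneg_left (card_collar_le hν hR hD) (by positivity)
  have h3 : ∑ T ∈ C, cost W T ≤ ∑ T ∈ triF ν R, cost W T :=
    Finset.sum_le_sum_of_subset_of_nonneg hCs fun T _ _ => cost_nonneg _ _
  have h4 := mul_le_mul_of_nonneg_left h3 (show 0 ≤ 100 * K ^ 2 by positivity)
  linarith

/-- The four terms come from crossing triangles, triangles of wrong chirality, the slope of the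
cut-off with the loss in choosing the cut, and the energy already present. In the third, the collar
has order `J K / ε` triangles, so the factors `ε`, `1 / J` and `1 / K ^ 2` leave `1 / K`. -/
theorem layer_error_le {ε K J E τ B C S : ℝ} (hε : 0 < ε) (hε1 : ε ≤ 1 / 2) (hK : 2 ≤ K)
    (hJ : 1 ≤ J) (hB : B * (ε ^ 2 / 200) ≤ τ) (hS : ε * S ≤ E)
    (hC : C ≤ 1600 * (4 + J * K + 2)) :
    ε * (9 * C + 2 / J * (9 * B
      + 600 / K ^ 2 * (800 * ((4 + J * K + 2) * (2 * (1 / (2 * ε)) + 2))) + 100 * K ^ 2 * S))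
      ≤ 100800 * (ε * J * K) + 3600 * τ / (ε * J) + 13440000 / K + 200 * K ^ 2 * E / J := by
  have hJ0 : 0 < J := by linarith
  have hK0 : 0 < K := by linarith
  have hJK : 1 ≤ J * K := by nlinarith
  have hD : 4 + J * K + 2 ≤ 7 * (J * K) := by linarith
  have e1 : ε * (9 * C) ≤ 100800 * (ε * J * K) := by
    have : 9 * C ≤ 100800 * (J * K) := by linarith
    calc ε * (9 * C) ≤ ε * (100800 * (J * K)) := by gcongr
      _ = _ := by ring
  have e2 : ε * (2 / J * (9 * B)) ≤ 3600 * τ / (ε * J) := by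
    rw [le_div_iff₀ (by positivity)]
    have : ε * (2 / J * (9 * B)) * (ε * J) = 3600 * (B * (ε ^ 2 / 200)) := by
      field_simp; ring
    rw [this]; linarith
  have e3 : ε * (2 / J * (600 / K ^ 2 * (800 * ((4 + J * K + 2) * (2 * (1 / (2 * ε)) + 2)))))
      ≤ 13440000 / K := by
    have h1 : ε * (2 * (1 / (2 * ε)) + 2) ≤ 2 := by
      have : ε * (2 * (1 / (2 * ε)) + 2) = 1 + 2 * ε := by field_simp
      linarith
    calc ε * (2 / J * (600 / K ^ 2 * (800 * ((4 + J * K + 2) * (2 * (1 / (2 * ε)) + 2)))))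
        = 960000 / (J * K ^ 2) * ((4 + J * K + 2) * (ε * (2 * (1 / (2 * ε)) + 2))) := by ring
      _ ≤ 960000 / (J * K ^ 2) * (7 * (J * K) * 2) := by gcongr
      _ = 13440000 / K := by field_simp; norm_num
  have e4 : ε * (2 / J * (100 * K ^ 2 * S)) ≤ 200 * K ^ 2 * E / J := by
    have : ε * (2 / J * (100 * K ^ 2 * S)) = 200 * K ^ 2 * (ε * S) / J := by ring
    rw [this]; gcongr
  have : ε * (9 * C + 2 / J * (9 * B
      + 600 / K ^ 2 * (800 * ((4 + J * K + 2) * (2 * (1 / (2 * ε)) + 2))) + 100 * K ^ 2 * S))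
      = ε * (9 * C) + ε * (2 / J * (9 * B))
        + ε * (2 / J * (600 / K ^ 2 * (800 * ((4 + J * K + 2) * (2 * (1 / (2 * ε)) + 2)))))
        + ε * (2 / J * (100 * K ^ 2 * S)) := by ring
  linarith

theorem cellMin_le_energy_add {ν : Plane} (hν : ‖ν‖ = 1) {ε : ℝ} (hε : 0 < ε) (hε1 : ε ≤ 1 / 2)
    {K : ℝ} (hK : 2 ≤ K) {J : ℕ} (hJ : 0 < J) (hJK : 4 + J * K + 1 ≤ 1 / (2 * ε))
    (u : SpinField ε) {E τ : ℝ} (hE : 0 ≤ E) (hτ : 0 ≤ τ)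
    (hu : energy u (square ν) ≤ ENNReal.ofReal E)
    (hχ : eLpNorm (fun x => chirality u x - jump ν x) 1 (volume.restrict (rect 1 1 ν))
      ≤ ENNReal.ofReal τ) :
    cellMin ε ν ≤ energy u (square ν) + ENNReal.ofReal (100800 * (ε * J * K)
      + 3600 * τ / (ε * J) + 13440000 / K + 200 * K ^ 2 * E / J) := by
  classical
  have hK0 : 0 < K := by linarith
  have hJ1 : (1 : ℝ) ≤ J := by exact_mod_cast hJ
  have hD : 0 ≤ 4 + J * K := by positivity
  obtain ⟨r, hr, hlayer⟩ := exists_layer hν (R := 1 / (2 * ε)) hK hJ (triF ν (1 / (2 * ε)))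
    (weight_nonneg ν K u.ext)
  have hr' : 4 + ((r : ℝ) + 1) * K ≤ 4 + J * K := by
    have : (r : ℝ) + 1 ≤ J := by exact_mod_cast hr
    gcongr
  obtain ⟨φ, hφ⟩ := exists_damped_sum_le hν (1 / (2 * ε)) hK0 hr' u.ext (triF ν (1 / (2 * ε)))
  refine (cellMin_le_energy (damped_mem_admissible hν hε hK0 r φ u.ext)).trans ?_
  rw [energy_square_eq hν hε] at hu ⊢
  rw [ENNReal.ofReal_le_ofReal_iff hE] at hu
  rw [energy_square_eq hν hε, ← ENNReal.ofReal_add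
    (mul_nonneg hε.le (Finset.sum_nonneg fun T _ => cost_nonneg _ _)) (by positivity)]
  apply ENNReal.ofReal_le_ofReal
  simp only [cost_ofUnit hε]
  have hw := sum_weight_le (K := K) hν (R := 1 / (2 * ε)) (by positivity) hD u.ext
  have hw' := mul_le_mul_of_nonneg_left hw (show 0 ≤ 2 / (J : ℝ) by positivity)
  have herr := layer_error_le hε hε1 hK hJ1 (card_bad_le hν hε u hτ hχ) hu
    (card_crossing_le hν hD hJK)
  have h1 := mul_le_mul_of_nonneg_left (hφ.trans (add_le_add_right (hlayer.trans hw') _)) hε.le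
  linarith

/-- Fields of bounded energy with chirality close to the pure jump can be changed at a small cost
so that they attain the boundary data. -/
theorem exists_cellMin_le_add {ν : Plane} (hν : ‖ν‖ = 1) {E κ : ℝ} (hE : 0 ≤ E) (hκ : 0 < κ) :
    ∃ ε₀ > 0, ∃ τ > 0, ∀ ε, 0 < ε → ε < ε₀ → ∀ u : SpinField ε,
      energy u (square ν) ≤ ENNReal.ofReal E →
      eLpNorm (fun x => chirality u x - jump ν x) 1 (volume.restrict (rect 1 1 ν))
        ≤ ENNReal.ofReal τ →
      cellMin ε ν ≤ energy u (square ν) + ENNReal.ofReal κ := by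
  -- Each of the four errors is made at most `κ / 4`: `K` handles the slope, `δ` the crossing
  -- triangles, and the thresholds for `τ` and `ε`, which depend on both, the other two.
  set K : ℝ := max 2 (4 * 13440000 / κ) with hKdef
  have hK : 2 ≤ K := le_max_left _ _
  have hK0 : 0 < K := by linarith
  have hKκ : 13440000 / K ≤ κ / 4 := by
    have : 4 * 13440000 / κ ≤ K := le_max_right _ _
    rw [div_le_iff₀ hκ] at this
    rw [div_le_iff₀ hK0]; linarith
  set δ : ℝ := min (1 / 100) (κ / (4 * 100800)) with hδdef
  have hδ : 0 < δ := by positivity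
  have hδ1 : δ ≤ 1 / 100 := min_le_left _ _
  have hδκ : 100800 * δ ≤ κ / 4 := by
    have : δ ≤ κ / (4 * 100800) := min_le_right _ _
    linarith
  refine ⟨min (1 / 100) (min (δ / (2 * K)) (κ * δ / (1600 * K ^ 3 * (E + 1)))), by positivity,
    κ * δ / (28800 * K), by positivity, ?_⟩
  intro ε hε hlt u hu hχ
  rw [lt_min_iff, lt_min_iff] at hlt
  obtain ⟨hε1, hε2, hε3⟩ := hlt
  rw [lt_div_iff₀ (by positivity)] at hε2 hε3
  -- The collar then has macroscopic width `J * (ε * K)` between `δ / 2` and `δ`, so `J` grows like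
  -- `1 / ε`.
  set J := ⌊δ / (ε * K)⌋₊ with hJdef
  have hq : 2 ≤ δ / (ε * K) := by rw [le_div_iff₀ (by positivity)]; linarith
  have hJle : (J : ℝ) * (ε * K) ≤ δ := by
    rw [← le_div_iff₀ (by positivity)]; exact Nat.floor_le (by positivity)
  have hJge : δ ≤ 2 * (J * (ε * K)) := by
    have h1 : δ / (ε * K) < J + 1 := Nat.lt_floor_add_one _
    have h2 : δ / (ε * K) ≤ 2 * J := by linarith
    rw [div_le_iff₀ (by positivity)] at h2
    linarith
  have hJ : 0 < J := Nat.floor_pos.2 (by linarith)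
  have hJ0 : (0 : ℝ) < J := by exact_mod_cast hJ
  have hJK : 4 + J * K + 1 ≤ 1 / (2 * ε) := by
    rw [le_div_iff₀ (by positivity)]
    nlinarith
  refine (cellMin_le_energy_add hν hε (by linarith) hK hJ hJK u hE (by positivity) hu hχ).trans ?_
  gcongr
  have e1 : 100800 * (ε * J * K) ≤ κ / 4 := by
    have : ε * J * K = J * (ε * K) := by ring
    rw [this]; linarith
  have e2 : 3600 * (κ * δ / (28800 * K)) / (ε * J) ≤ κ / 4 := by
    rw [div_le_iff₀ (by positivity)]
    have : 3600 * (κ * δ / (28800 * K)) = κ / 8 * (δ / K) := by field_simp; norm_num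
    rw [this]
    have h1 : δ / K ≤ 2 * (ε * J) := by
      rw [div_le_iff₀ hK0]; linarith
    calc κ / 8 * (δ / K) ≤ κ / 8 * (2 * (ε * J)) := by gcongr
      _ = _ := by ring
  have e3 : 200 * K ^ 2 * E / J ≤ κ / 4 := by
    rw [div_le_iff₀ hJ0]
    have h1 : 1600 * K ^ 3 * (E + 1) * ε ≤ κ * (2 * (J * (ε * K))) := by
      have := mul_le_mul_of_nonneg_left hJge hκ.le
      linarith
    have h2 : 1600 * K ^ 2 * (E + 1) ≤ 2 * κ * J := by
      have : (1600 * K ^ 2 * (E + 1)) * (ε * K) ≤ (2 * κ * J) * (ε * K) := by linarith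
      exact le_of_mul_le_mul_right this (by positivity)
    nlinarith [sq_nonneg K]
  linarith

/-- For any `b` above the lower limit, infinitely many fields have energy below `b` and can be made
admissible at arbitrarily small cost. Since the cell minima converge along the whole sequence, a
bound at infinitely many indices is enough. -/
theorem phi_le_liminf {ν : Plane} (hν : ‖ν‖ = 1) {ε : ℕ → ℝ} {u : ∀ n, SpinField (ε n)}
    (hpos : ∀ n, 0 < ε n) (hlim : Tendsto ε atTop (𝓝 0))
    (hχ : Tendsto (fun n => eLpNorm (fun x => chirality (u n) x - jump ν x) 1
      (volume.restrict (rect 1 1 ν))) atTop (𝓝 0)) :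
    phi ν ≤ liminf (fun n => energy (u n) (square ν)) atTop := by
  refine le_of_forall_gt_imp_ge_of_dense fun b hb => ?_
  rcases eq_or_ne b ⊤ with rfl | hbt
  · exact le_top
  refine ENNReal.le_of_forall_pos_le_add fun κ hκ _ => ?_
  obtain ⟨ε₀, hε₀, τ, hτ, hmain⟩ := exists_cellMin_le_add hν (E := b.toReal) (κ := κ)
    ENNReal.toReal_nonneg hκ
  have h1 : ∃ᶠ n in atTop, energy (u n) (square ν) < b :=
    frequently_lt_of_liminf_lt (by isBoundedDefault) hb
  have h2 : ∀ᶠ n in atTop, ε n < ε₀ := hlim.eventually_lt_const hε₀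
  have h3 : ∀ᶠ n in atTop, eLpNorm (fun x => chirality (u n) x - jump ν x) 1
      (volume.restrict (rect 1 1 ν)) < ENNReal.ofReal τ :=
    hχ.eventually_lt_const (ENNReal.ofReal_pos.2 hτ)
  have hε : Tendsto ε atTop (𝓝[>] 0) :=
    tendsto_nhdsWithin_iff.2 ⟨hlim, Eventually.of_forall hpos⟩
  have h4 := (tendsto_cellMin hν).comp hε
  refine le_of_tendsto_of_frequently h4 ?_
  refine (h1.and_eventually (h2.and h3)).mono fun n hn => ?_
  obtain ⟨hb', h2', h3'⟩ := hn
  have := hmain (ε n) (hpos n) h2' (u n) (by rw [ENNReal.ofReal_toReal hbt]; exact hb'.le) h3'.le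
  rw [ENNReal.ofReal_coe_nnreal] at this
  exact this.trans (by gcongr)

end AFXY

end

theorem proposition4p2 (ν : AFXY.Plane) (hν : ‖ν‖ = 1) :
    (Tendsto (fun ε => AFXY.cellMin ε ν) (𝓝[>] (0 : ℝ)) (𝓝 (AFXY.phi ν)) ∧ AFXY.phi ν < ⊤) ∧
      AFXY.phi ν ≤ AFXY.psi 1 1 ν := by
  refine ⟨⟨AFXY.tendsto_cellMin hν, AFXY.phi_lt_top hν⟩, ?_⟩
  rw [AFXY.psi, ENNReal.ofReal_one, inv_one, one_mul]
  refine le_sInf ?_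
  rintro E ⟨ε, u, hpos, hlim, hχ, rfl⟩
  exact AFXY.phi_le_liminf hν hpos hlim hχ
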